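/- Let $n\ge 1$, let $f$ be a monotone Boolean function of $x_1,\dots,x_n$ and $\varphi$ its prime CNF (the conjunction of all prime implicates of $f$), in which all of $x_1,\dots,x_n$ occur. Let $PI(f)$ be the set of prime implicants of $f$; $\psi=\bigvee_{t\in PI(f)}t$ is the prime DNF of $f$. $V(t)$ is the set of variables of $t$, $|\cdot|$ counts the terms of a DNF, and $\|\varphi\|$ is the number of literals in $\varphi$. For a term $t$, $t_i$ is the conjunction of the variables of $t$ among $x_1,\dots,x_i$. Let $\varphi_i$ consist of the clauses of $\varphi$ with all variables among $x_1,\dots,x_i$ (i.e. $\varphi$ with $x_j=1$ for $j>i$), let $f_i$ be the function it represents, and let $\Delta^i$ consist of the clauses in $\varphi_i$ but not in $\varphi_{i-1}$. Let $\Delta^i[t]$ be the CNF of all clauses $c$ such that $c$ has no variable in common with $t_{i-1}$ and $c\vee x_i$ (with $x_i\notin c$) is in $\Delta^i$, and let $\rho_{(t,i)}$ be the prime DNF of the function represented by $\Delta^i[t]$ (so $|\rho_{(t,i)}|=1$ if $\Delta^i[t]=1$, and $|\rho_{(t,i)}|=0$ if $\Delta^i[t]=0$). A term $s$ is smaller than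 $t$ if $\sum_{x_j\in V(s)}2^{n-j}<\sum_{x_j\in V(t)}2^{n-j}$. Algorithm Dualize: compute the smallest prime implicant of $f$ and put it into $Q$. While $Q\ne\emptyset$: remove the smallest $t$ from $Q$ and output it; for each $i$ with $x_i\in V(t)$ and $\Delta^i[t]\neq 1$, compute $\rho_{(t,i)}$ by a subroutine, and for each term $t'$ of $\rho_{(t,i)}$ such that $t_{i-1}\wedge t'$ is a prime implicant of $f_i$, add to $Q$ the smallest prime implicant $t^*$ of $f$ with $t^*_i=t_{i-1}\wedge t'$. Here $Q$ is stored as a binary tree of depth $n$, and time is the number of steps of a unit-cost random access machine. Let $T_{(t,i)}$ bound the time that the subroutine takes to compute $\rho_{(t,i)}$ from $\Delta^i[t]$, for $t\in PI(f)$ and $x_i\in V(t)$. Theorem. There is an absolute constant $C$ such that, for all such $n$, $f$, $\varphi$, every listing of $\varphi$ as input, and every subroutine, Algorithm Dualize terminates after having output each $t\in PI(f)$ exactly once, in increasing order, and: (a) If some clause of $\varphi$ has at least two variables, then the output delay (the time before the first output, between two consecutive outputs, and after the last output) is at most $$\max_{t\in PI(f)}\ \sum_{x_i\in V(t)}\bigl(T_{(t,i)}+|\rho_{(t,i)}|\cdot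 C\|\varphi\|\bigr),$$ and the total time is at most $$\sum_{t\in PI(f)}\ \sum_{x_i\in V(t)}\bigl(T_{(t,i)}+|\rho_{(t,i)}|\cdot C\|\varphi\|\bigr).$$ (b) In the remaining case $\varphi=x_1\wedge\dots\wedge x_n$, where all $|\rho_{(t,i)}|$ are $0$, the same two bounds hold with $C\|\varphi\|$ added. (c) $|\rho_{(t,i)}|\le|\psi|$ for all $t\in PI(f)$ and $x_i\in V(t)$. -/

import Mathlib

/-! ### Monotone Boolean functions, prime CNFs and prime DNFs

The variables are `x_0, …, x_{n-1}`, i.e. the elements of `Fin n`.  All functions below are monotone,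
so all prime implicants and prime implicates consist of positive literals; accordingly a term or a
clause is the set of the variables that occur in it, a CNF is a set of clauses and a DNF is a set of
terms.  The empty term is `1`, the empty clause is `0`, the empty CNF is `1`, the empty DNF is `0`. -/

namespace Dualization

variable {n : ℕ}

/-- `t ≤ f` for the term `t`. -/
def IsImplicant (f : (Fin n → Bool) → Bool) (t : Finset (Fin n)) : Prop :=
  ∀ v : Fin n → Bool, (∀ j ∈ t, v j = true) → f v = true

/-- `f ≤ c` for the clause `c`. -/
def IsImplicate (f : (Fin n → Bool) → Bool) (c : Finset (Fin n)) : Prop :=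
  ∀ v : Fin n → Bool, f v = true → ∃ j ∈ c, v j = true

/-- `PI(f)`, which is also the prime DNF of `f`. -/
noncomputable def primeImplicants (f : (Fin n → Bool) → Bool) : Finset (Finset (Fin n)) :=
  open Classical in Finset.univ.filter (fun t => Minimal (IsImplicant f) t)

/-- `φ` is the prime CNF of `f`: its clauses are exactly the prime implicates. -/
def IsPrimeCNF (f : (Fin n → Bool) → Bool) (φ : Finset (Finset (Fin n))) : Prop :=
  ∀ c : Finset (Fin n), c ∈ φ ↔ Minimal (IsImplicate f) c

/-- The function represented by a CNF. -/
def cnfFun (φ : Finset (Finset (Fin n))) : (Fin n → Bool) → Bool :=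
  fun v => decide (∀ c ∈ φ, ∃ j ∈ c, v j = true)

/-- The length `‖φ‖`, i.e. the number of literals. -/
def length (φ : Finset (Finset (Fin n))) : ℕ := ∑ c ∈ φ, c.card

/-- The CNF obtained from `φ` by fixing to `1` all variables but the first `k` ones. -/
def fixed (φ : Finset (Finset (Fin n))) (k : ℕ) : Finset (Finset (Fin n)) :=
  φ.filter (fun c => ∀ j ∈ c, j.val < k)

/-- `Δ^i`: the clauses that `x_i` adds, i.e. those left when the variables after `x_i` are fixed
to `1`, but not when `x_i` is fixed too. -/
def delta (φ : Finset (Finset (Fin n))) (i : Fin n) : Finset (Finset (Fin n)) :=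
  fixed φ (i.val + 1) \ fixed φ i.val

/-- `Δ^i[t]`: the clauses `c` without `x_i` such that `c ∨ x_i` is in `Δ^i` and `c` has no variable
in common with the part of `t` before `x_i`. -/
def residual (φ : Finset (Finset (Fin n))) (i : Fin n) (t : Finset (Fin n)) :
    Finset (Finset (Fin n)) :=
  ((delta φ i).image (fun c => c.erase i)).filter (fun c => Disjoint c (t.filter (fun j => j < i)))

/-- `ρ_{(t,i)}`, the prime DNF of the function represented by `Δ^i[t]`. -/
noncomputable def rho (φ : Finset (Finset (Fin n))) (t : Finset (Fin n)) (i : Fin n) :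
    Finset (Finset (Fin n)) :=
  primeImplicants (cnfFun (residual φ i t))

/-- Terms are compared as `0`-`1` vectors, lexicographically, the first variable being the most
significant one. -/
def weight (t : Finset (Fin n)) : ℕ := ∑ j ∈ t, 2 ^ (n - 1 - j.val)

/-! ### The cost model

A unit-cost random access machine.  Lists and trees are linked cells and arrays are blocks of memory.
A computation is a value together with the number of steps spent; every call of a function that
inspects its data and every pass of every loop is charged one step, as is each array access; between
two charges only a bounded number of elementary operations is executed (inspecting or allocating one
cell, comparing or copying indices and bits).  Creating an array or printing one costs its length.
Each array that is written to is used destructively: no older version of it is read afterwards. -/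

/-- The result of a computation and the number of steps that it took. -/
structure Timed (α : Type) where
  val : α
  time : ℕ

instance : Monad Timed where
  pure a := ⟨a, 0⟩
  bind x g := ⟨(g x.val).val, x.time + (g x.val).time⟩

/-- Spend `k` steps. -/
def charge (k : ℕ) : Timed Unit := ⟨(), k⟩

/-- The loop "for each `a` in `l`", with loop state `b`. -/
def loop {α β : Type} (g : β → α → Timed β) : β → List α → Timed β
  | b, [] => do
      charge 1
      return b
  | b, a :: l => do
      charge 1
      let b' ← g b a
      loop g b' l

/-- Arrays of length `n`. -/
abbrev Arr (n : ℕ) (α : Type) : Type := Fin n → α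

/-- A new array filled with `a`. -/
def Arr.new {α : Type} (n : ℕ) (a : α) : Timed (Arr n α) := do
  charge (n + 1)
  return fun _ => a

/-- Array access. -/
def Arr.get {α : Type} (A : Arr n α) (j : Fin n) : Timed α := do
  charge 1
  return A j

/-- Array update. -/
def Arr.set {α : Type} (A : Arr n α) (j : Fin n) (a : α) : Timed (Arr n α) := do
  charge 1
  return Function.update A j a

/-- The term whose characteristic vector is `A`. -/
def support (A : Arr n Bool) : Finset (Fin n) := Finset.univ.filter (fun j => A j = true)

/-- `L` lists the members of `φ` without repetitions, each as a list without repetitions. -/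
def Represents (L : List (List (Fin n))) (φ : Finset (Finset (Fin n))) : Prop :=
  (L.map List.toFinset).Nodup ∧ (∀ l ∈ L, l.Nodup) ∧ (L.map List.toFinset).toFinset = φ

/-! ### The queue

A binary tree whose leaves at depth `n` are the terms in it: the left (right) son of a node at depth
`j` holds the terms that do (do not) contain `x_j`. -/

/-- Binary trees; no node of a queue has two empty sons. -/
inductive Tree : Type
  | empty : Tree
  | leaf : Tree
  | node (left right : Tree) : Tree

/-- A node, unless both sons are empty. -/
def Tree.mk : Tree → Tree → Tree
  | .empty, .empty => .empty
  | l, r => .node l r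

/-- Insert the term with characteristic vector `A`, the variables still to be read being listed
in the second argument. -/
def Tree.insert (A : Arr n Bool) : List (Fin n) → Tree → Timed Tree
  | [], _ => do
      charge 1
      return .leaf
  | j :: js, .node l r => do
      charge 1
      if ← A.get j then
        let l' ← Tree.insert A js l
        return .node l' r
      else
        let r' ← Tree.insert A js r
        return .node l r'
  | j :: js, _ => do
      charge 1
      if ← A.get j then
        let l' ← Tree.insert A js .empty
        return .node l' .empty
      else
        let r' ← Tree.insert A js .empty
        return .node .empty r'

/-- Remove the smallest term and write it into the all-zero array `A`. -/
def Tree.popMin : List (Fin n) → Tree → Arr n Bool → Timed (Arr n Bool × Tree)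
  | j :: js, .node l .empty, A => do
      charge 1
      let A' ← A.set j true
      let (T, l') ← Tree.popMin js l A'
      return (T, Tree.mk l' .empty)
  | _ :: js, .node l r, A => do
      charge 1
      let (T, r') ← Tree.popMin js r A
      return (T, Tree.mk l r')
  | _, _, A => do
      charge 1
      return (A, .empty)

/-! ### Algorithm Dualize -/

/-- The last variable of a clause. -/
def lastVar (c : List (Fin n)) : Timed (Option (Fin n)) :=
  loop (fun m j => do
    match m with
    | none => return some j
    | some k => return some (if k < j then j else k)) none c

/-- Sort the clauses of the input by their last variable: entry `i` of the result lists `Δ^i`. -/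
def buckets (L : List (List (Fin n))) : Timed (Arr n (List (List (Fin n)))) := do
  let B ← Arr.new n []
  loop (fun B c => do
    match ← lastVar c with
    | none => return B
    | some i =>
        let l ← B.get i
        B.set i (c :: l)) B L

/-- Does the term `A` contain a variable of the clause `c`? -/
def hits (A : Arr n Bool) (c : List (Fin n)) : Timed Bool :=
  loop (fun h j => do
    let b ← A.get j
    return h || b) false c

/-- Extend the term `A` to its smallest completion: from the variable with index `k` on, variables are
added only if they are needed for some clause in which they are the last variable. -/
def complete (B : Arr n (List (List (Fin n)))) (k : ℕ) (A : Arr n Bool) : Timed (Arr n Bool) :=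
  loop (fun A j => do
    if k ≤ j.val then
      let l ← B.get j
      let needed ← loop (fun b c => do
        let h ← hits A c
        return b || !h) false l
      if needed then A.set j true else return A
    else return A) A (List.finRange n)

/-- Build `Δ^i[t]` for the term `A` of `t`. -/
def buildResidual (B : Arr n (List (List (Fin n)))) (A : Arr n Bool) (i : Fin n) :
    Timed (List (List (Fin n))) := do
  let l ← B.get i
  loop (fun Γ c => do
    let (h, c') ← loop (fun (p : Bool × List (Fin n)) j => do
      if j = i then return p
      else
        let b ← A.get j
        return (p.1 || b, j :: p.2)) (false, []) c
    if h then return Γ else return (c' :: Γ)) [] l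

/-- The conjunction of the part of the term `A` before `x_i` and the term `t'`, in a new array. -/
def merge (A : Arr n Bool) (i : Fin n) (t' : List (Fin n)) : Timed (Arr n Bool) := do
  let S ← Arr.new n false
  let S ← loop (fun S j => do
    if j < i then
      let b ← A.get j
      S.set j b
    else return S) S (List.finRange n)
  loop (fun S j => S.set j true) S t'

/-- Is the term `S`, whose variables precede `x_i`, a prime implicant of the function that
results when the variables after `x_i` are fixed to `1`?  Every clause up to `Δ^i` must contain
a variable of `S`, and every variable of `S` must be the only one of `S` in some clause. -/
def isPrime (B : Arr n (List (List (Fin n)))) (S : Arr n Bool) (i : Fin n) : Timed Bool := do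
  let P ← Arr.new n false
  let (ok, P) ← loop (fun (s : Bool × Arr n Bool) k => do
    if k ≤ i then
      let l ← B.get k
      loop (fun (s : Bool × Arr n Bool) c => do
        let found ← loop (fun (h : List (Fin n)) j => do
          if ← S.get j then return j :: h else return h) [] c
        match found with
        | [] => return (false, s.2)
        | [j] =>
            let P' ← s.2.set j true
            return (s.1, P')
        | _ => return s) s l
    else return s) (true, P) (List.finRange n)
  loop (fun ok j => do
    let b ← S.get j
    let p ← P.get j
    return ok && (!b || p)) ok (List.finRange n)

/-- Step 1: preprocess the input, compute the smallest prime implicant and put it into the queue. -/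
def start (L : List (List (Fin n))) : Timed (Arr n (List (List (Fin n))) × Tree) := do
  let B ← buckets L
  let Z ← Arr.new n false
  let A ← complete B 0 Z
  let Q ← Tree.insert A (List.finRange n) .empty
  return (B, Q)

/-- First part of a pass of step 2: remove the smallest term from the nonempty queue and print it. -/
def emit (n : ℕ) (Q : Tree) : Timed (Arr n Bool × Tree) := do
  charge 1
  let Z ← Arr.new n false
  let p ← Tree.popMin (List.finRange n) Q Z
  charge n
  return p

/-- The rest of a pass of step 2 for the term `A`; `D` is the subroutine that is called to compute
the prime DNF of `Δ^i[t]`. -/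
def process (B : Arr n (List (List (Fin n))))
    (D : List (List (Fin n)) → Timed (List (List (Fin n))))
    (A : Arr n Bool) (Q : Tree) : Timed Tree :=
  loop (fun Q i => do
    if ← A.get i then
      match ← buildResidual B A i with
      | [] => return Q
      | c :: Γ =>
          let ρ ← D (c :: Γ)
          loop (fun Q t' => do
            let S ← merge A i t'
            if ← isPrime B S i then
              let A' ← complete B (i.val + 1) S
              Tree.insert A' (List.finRange n) Q
            else return Q) Q ρ
    else return Q) Q (List.finRange n)

/-- `Loop B D Q clock out total`: step 2, started with queue `Q` when `clock` steps have been
made, prints the terms in `out`, in this order and each with the number of steps made up to then,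
and terminates after `total` steps. -/
inductive Loop (B : Arr n (List (List (Fin n))))
    (D : List (List (Fin n)) → Timed (List (List (Fin n)))) :
    Tree → ℕ → List (ℕ × Finset (Fin n)) → ℕ → Prop
  | halt (clock : ℕ) : Loop B D .empty clock [] (clock + 1)
  | pass (Q : Tree) (clock : ℕ) (out : List (ℕ × Finset (Fin n))) (total : ℕ) (hQ : Q ≠ .empty)
      (h : Loop B D (process B D (emit n Q).val.1 (emit n Q).val.2).val
        (clock + (emit n Q).time + (process B D (emit n Q).val.1 (emit n Q).val.2).time) out total) :
      Loop B D Q clock ((clock + (emit n Q).time, support (emit n Q).val.1) :: out) total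

/-- Algorithm Dualize with the subroutine `D`, run on the list `L` of clauses, prints `out` (with time
stamps) and terminates after `total` steps. -/
def DualizeRun (L : List (List (Fin n)))
    (D : List (List (Fin n)) → Timed (List (List (Fin n))))
    (out : List (ℕ × Finset (Fin n))) (total : ℕ) : Prop :=
  Loop (start L).val.1 D (start L).val.2 (start L).time out total

/-- The output delay is at most `M`: at most `M` steps are made before the first output, between two
consecutive outputs, and after the last output. -/
def DelayAtMost (M : ℕ) (out : List (ℕ × Finset (Fin n))) (total : ℕ) : Prop :=
  List.IsChain (fun a b => b ≤ a + M) ((0 :: out.map Prod.fst) ++ [total])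

/-- `∑_{x_i ∈ V(t)} (T_{(t,i)} + |ρ_{(t,i)}| · C · ‖φ‖)`. -/
noncomputable def passBound (φ : Finset (Finset (Fin n))) (T : Finset (Fin n) → Fin n → ℕ) (C : ℕ)
    (t : Finset (Fin n)) : ℕ :=
  ∑ i ∈ t, (T t i + (rho φ t i).card * (C * length φ))

end Dualization

/-!
The prime implicants of `f` are the minimal transversals of `φ`. The smallest one arises from the
empty set by scanning the variables and adding `x_i` only when some clause of `Δ^i` is still missed.
For any other one, `t`, let `i` be the last index such that the part of `t` before `x_i` is not a
minimal transversal of `φ_{i-1}`. Then `x_i ∉ t`, and if `s` is a minimal transversal of `φ_{i-1}`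
properly contained in `t_i`, some clause of `Δ^i` is missed by `s`, so the smallest completion `u`
of `s ∪ {x_i}` contains `x_i`. Since `t_i \ s` is in `ρ_{(u,i)}`, the term `t` is put into the queue
in the pass for `u`. Everything put into the queue in the pass for `u` is larger than `u`, so the
smallest term not yet printed is always in the queue: terms are printed in increasing order, once
each.

A pass costs `T_{(t,i)} + O(|ρ_{(t,i)}| ‖φ‖)` for each `x_i ∈ V(t)` and `O(‖φ‖)` in addition. If
some clause has two variables, `Δ^i[t]` is never `0` for the variables `x_i ∈ t` of that clause
because `φ` is an antichain, hence `|ρ_{(t,i)}| ≥ 1` and the additional cost is absorbed. Finally,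
each `r` in `ρ_{(t,i)}` is `u_{i-1} \ t` for some prime implicant `u`, so `|ρ_{(t,i)}| ≤ |ψ|`.
-/

namespace Dualization

variable {n : ℕ}

/-! ### Transversals -/

section Transversal

variable {α : Type*} [DecidableEq α] {ψ χ : Finset (Finset α)} {s t : Finset α} {a : α}

/-- The set `t` meets every member of the family `ψ`. Regarding `ψ` as a monotone CNF and `t` as a
term, this says that `t` is an implicant of `ψ`. -/
def IsTransversal (ψ : Finset (Finset α)) (t : Finset α) : Prop :=
  ∀ c ∈ ψ, (c ∩ t).Nonempty

theorem IsTransversal.mono (h : IsTransversal ψ s) (hst : s ⊆ t) : IsTransversal ψ t :=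
  fun c hc => (h c hc).mono (Finset.inter_subset_inter_left hst)

theorem IsTransversal.anti (h : IsTransversal ψ t) (hχ : χ ⊆ ψ) : IsTransversal χ t :=
  fun c hc => h c (hχ hc)

theorem isTransversal_union :
    IsTransversal (ψ ∪ χ) t ↔ IsTransversal ψ t ∧ IsTransversal χ t := by
  simp only [IsTransversal, Finset.mem_union, or_imp, forall_and]

theorem isTransversal_univ [Fintype α] (hψ : ∅ ∉ ψ) : IsTransversal ψ Finset.univ := fun c hc => by
  rw [Finset.inter_univ]
  exact Finset.nonempty_iff_ne_empty.2 fun h => hψ (h ▸ hc)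

theorem IsTransversal.exists_minimal_subset (h : IsTransversal ψ t) :
    ∃ s ⊆ t, Minimal (IsTransversal ψ) s :=
  exists_minimal_le_of_wellFoundedLT _ t h

theorem minimal_isTransversal_iff :
    Minimal (IsTransversal ψ) t ↔ IsTransversal ψ t ∧ ∀ a ∈ t, ∃ c ∈ ψ, c ∩ t = {a} := by
  refine ⟨fun h => ⟨h.prop, fun a ha => ?_⟩, fun ⟨ht, hpriv⟩ => ⟨ht, fun s hs hst a ha => ?_⟩⟩
  · have hnot : ¬ IsTransversal ψ (t.erase a) := fun h' =>
      Finset.notMem_erase a t (h.le_of_le h' (Finset.erase_subset a t) ha)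
    obtain ⟨c, hc, hempty⟩ : ∃ c ∈ ψ, (c ∩ t).erase a = ∅ := by
      simpa [IsTransversal, Finset.inter_erase] using hnot
    refine ⟨c, hc, (Finset.erase_eq_empty_iff _ _).1 hempty |>.resolve_left ?_⟩
    exact (h.prop c hc).ne_empty
  · obtain ⟨c, hc, hct⟩ := hpriv a ha
    have hsub : c ∩ s ⊆ {a} := hct ▸ Finset.inter_subset_inter_left hst
    obtain ⟨b, hb⟩ := hs c hc
    exact Finset.mem_singleton.1 (hsub hb) ▸ (Finset.mem_inter.1 hb).2

theorem minimal_isTransversal_sdiff (ht : Minimal (IsTransversal ψ) t) (hst : s ⊆ t) :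
    Minimal (IsTransversal {c ∈ ψ | Disjoint c s}) (t \ s) := by
  have hinter : ∀ c, Disjoint c s → c ∩ (t \ s) = c ∩ t := fun c hc => by
    rw [← Finset.inter_sdiff_assoc, Finset.sdiff_eq_self_of_disjoint]
    exact hc.mono_left Finset.inter_subset_left
  obtain ⟨htr, hpriv⟩ := minimal_isTransversal_iff.1 ht
  refine minimal_isTransversal_iff.2 ⟨fun c hc => ?_, fun a ha => ?_⟩
  · obtain ⟨hc, hcs⟩ := Finset.mem_filter.1 hc
    exact hinter c hcs ▸ htr c hc
  · obtain ⟨hat, has⟩ := Finset.mem_sdiff.1 ha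
    obtain ⟨c, hc, hct⟩ := hpriv a hat
    have hcs : Disjoint c s := Finset.disjoint_left.2 fun b hbc hbs => by
      have hb : b ∈ c ∩ t := Finset.mem_inter.2 ⟨hbc, hst hbs⟩
      rw [hct, Finset.mem_singleton] at hb
      exact has (hb ▸ hbs)
    exact ⟨c, Finset.mem_filter.2 ⟨hc, hcs⟩, (hinter c hcs).trans hct⟩

theorem isTransversal_image_erase :
    IsTransversal (ψ.image (·.erase a)) t ↔ IsTransversal ψ (t.erase a) := by
  simp only [IsTransversal, Finset.forall_mem_image, Finset.erase_inter, Finset.inter_erase]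

theorem minimal_isTransversal_image_erase :
    Minimal (IsTransversal (ψ.image (·.erase a))) t ↔ a ∉ t ∧ Minimal (IsTransversal ψ) t := by
  constructor
  · intro h
    have ha : a ∉ t := fun ha =>
      Finset.notMem_erase a t (h.le_of_le (isTransversal_image_erase.2 (by
        simpa using isTransversal_image_erase.1 h.prop)) (Finset.erase_subset a t) ha)
    refine ⟨ha, by simpa [ha] using isTransversal_image_erase.1 h.prop, fun s hs hst => ?_⟩
    have has : a ∉ s := fun h => ha (hst h)
    exact h.le_of_le (isTransversal_image_erase.2 (by rwa [Finset.erase_eq_of_notMem has])) hst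
  · rintro ⟨ha, h⟩
    refine ⟨isTransversal_image_erase.2 (by simpa [ha] using h.prop), fun s hs hst => ?_⟩
    exact h.le_of_le ((isTransversal_image_erase.1 hs).mono (Finset.erase_subset a s)) hst

end Transversal

section MonotoneFunction

variable {f : (Fin n → Bool) → Bool} {φ ψ : Finset (Finset (Fin n))} {c t : Finset (Fin n)}

theorem isImplicant_cnfFun : IsImplicant (cnfFun ψ) = IsTransversal ψ := by
  funext t
  simp only [IsImplicant, cnfFun, decide_eq_true_eq, IsTransversal, Finset.Nonempty,
    Finset.mem_inter]
  refine propext ⟨fun h => ?_, fun h v hv c hc => ?_⟩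
  · simpa using h (fun j => decide (j ∈ t)) (by simp)
  · exact (h c hc).imp fun j hj => ⟨hj.1, hv j hj.2⟩

theorem mem_primeImplicants_cnfFun :
    t ∈ primeImplicants (cnfFun ψ) ↔ Minimal (IsTransversal ψ) t := by
  simp [primeImplicants, isImplicant_cnfFun]

theorem isImplicate_filter_eq_false (hf : Monotone f) {v : Fin n → Bool} (hv : f v = false) :
    IsImplicate f {j | v j = false} := by
  intro w hw
  by_contra! hcon
  have hwv : w ≤ v := fun j => by
    cases hj : v j
    · simp [hcon j (by simp [hj])]
    · exact Bool.le_true _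
  have := hf hwv
  rw [hw, hv] at this
  exact absurd this (by decide)

theorem IsPrimeCNF.eq_cnfFun (hφ : IsPrimeCNF f φ) (hf : Monotone f) : f = cnfFun φ := by
  funext v
  rw [Bool.eq_iff_iff, cnfFun, decide_eq_true_eq]
  refine ⟨fun h c hc => ((hφ c).1 hc).prop v h, fun h => ?_⟩
  by_contra hv
  obtain ⟨c, hcv, hc⟩ := exists_minimal_le_of_wellFoundedLT (IsImplicate f) _
    (isImplicate_filter_eq_false hf (Bool.eq_false_iff.2 hv))
  obtain ⟨j, hj, hvj⟩ := h c ((hφ c).2 hc)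
  simpa [hvj] using hcv hj

theorem IsPrimeCNF.isAntichain (hφ : IsPrimeCNF f φ) :
    IsAntichain (· ⊆ ·) (φ : Set (Finset (Fin n))) := by
  have : (φ : Set (Finset (Fin n))) = {c | Minimal (IsImplicate f) c} := Set.ext hφ
  rw [this]
  exact setOfPred_minimal_antichain _

theorem IsPrimeCNF.empty_notMem (hφ : IsPrimeCNF f φ) (hc : c ∈ φ) (hne : c.Nonempty) : ∅ ∉ φ :=
  fun h => hφ.isAntichain h hc hne.ne_empty.symm (Finset.empty_subset c)

end MonotoneFunction

/-! ### Prefixes and smallest completions -/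

section Prefix

variable {φ : Finset (Finset (Fin n))} {c s t : Finset (Fin n)} {i j : Fin n} {k m : ℕ}

theorem mem_fixed : c ∈ fixed φ k ↔ c ∈ φ ∧ ∀ j ∈ c, j.val < k := by
  simp [fixed]

theorem fixed_self (φ : Finset (Finset (Fin n))) : fixed φ n = φ := by
  ext c
  simp [mem_fixed]

theorem fixed_mono (φ : Finset (Finset (Fin n))) : Monotone (fixed φ) := fun _ _ hkm _ hc =>
  mem_fixed.2 ⟨(mem_fixed.1 hc).1, fun j hj => ((mem_fixed.1 hc).2 j hj).trans_le hkm⟩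

theorem fixed_succ (φ : Finset (Finset (Fin n))) (i : Fin n) :
    fixed φ (i + 1) = fixed φ i ∪ delta φ i :=
  (Finset.union_sdiff_of_subset (fixed_mono φ (Nat.le_succ i))).symm

theorem mem_delta : c ∈ delta φ i ↔ c ∈ φ ∧ i ∈ c ∧ ∀ j ∈ c, j ≤ i := by
  simp only [delta, Finset.mem_sdiff, mem_fixed, Nat.lt_succ_iff, Fin.val_fin_le]
  constructor
  · rintro ⟨⟨hc, hle⟩, hnot⟩
    refine ⟨hc, ?_, hle⟩
    by_contra hi
    exact hnot ⟨hc, fun j hj => (hle j hj).lt_of_ne (ne_of_mem_of_not_mem hj hi)⟩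
  · exact fun ⟨hc, hi, hle⟩ => ⟨⟨hc, hle⟩, fun h => (h.2 i hi).false⟩

/-- The part `t_k` of the term `t` among the first `k` variables. -/
def truncate (k : ℕ) (t : Finset (Fin n)) : Finset (Fin n) := {j ∈ t | j.val < k}

theorem mem_truncate : j ∈ truncate k t ↔ j ∈ t ∧ j.val < k := Finset.mem_filter

theorem truncate_zero : truncate 0 t = ∅ := by
  simp [truncate]

theorem truncate_eq_self : truncate k t = t ↔ ∀ j ∈ t, j.val < k := Finset.filter_eq_self

theorem truncate_self (t : Finset (Fin n)) : truncate n t = t :=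
  truncate_eq_self.2 fun j _ => j.isLt

theorem truncate_succ_of_mem (hi : i ∈ t) : truncate (i + 1) t = insert i (truncate i t) := by
  ext j
  simp only [mem_truncate, Finset.mem_insert, Nat.lt_succ_iff_lt_or_eq, ← Fin.ext_iff]
  grind

theorem truncate_succ_of_notMem (hi : i ∉ t) : truncate (i + 1) t = truncate i t := by
  ext j
  simp only [mem_truncate, Nat.lt_succ_iff_lt_or_eq, ← Fin.ext_iff]
  grind

theorem inter_truncate (hc : c ∈ fixed φ k) (t : Finset (Fin n)) : c ∩ truncate k t = c ∩ t := by
  ext j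
  simp only [Finset.mem_inter, mem_truncate]
  exact ⟨fun h => ⟨h.1, h.2.1⟩, fun h => ⟨h.1, h.2, (mem_fixed.1 hc).2 j h.1⟩⟩

theorem isTransversal_fixed_truncate :
    IsTransversal (fixed φ k) (truncate k t) ↔ IsTransversal (fixed φ k) t :=
  forall₂_congr fun c hc => by rw [inter_truncate hc]

theorem lt_of_mem_of_minimal_fixed (hs : Minimal (IsTransversal (fixed φ k)) s) (hj : j ∈ s) :
    j.val < k := by
  obtain ⟨c, hc, hcs⟩ := (minimal_isTransversal_iff.1 hs).2 j hj
  exact (mem_fixed.1 hc).2 j (Finset.mem_inter.1 (hcs ▸ Finset.mem_singleton_self j)).1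

/-- One step of the smallest completion: `x_i` joins the term `s` if this is needed for some clause
in which `x_i` is the last variable. -/
def extend (φ : Finset (Finset (Fin n))) (i : Fin n) (s : Finset (Fin n)) : Finset (Fin n) :=
  if ∃ c ∈ delta φ i, Disjoint c s then insert i s else s

theorem isTransversal_delta_iff :
    IsTransversal (delta φ i) s ↔ ¬ ∃ c ∈ delta φ i, Disjoint c s := by
  simp [IsTransversal, Finset.not_disjoint_iff_nonempty_inter]

theorem extend_of_isTransversal (h : IsTransversal (delta φ i) s) : extend φ i s = s :=
  if_neg (isTransversal_delta_iff.1 h)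

theorem extend_of_disjoint (hc : c ∈ delta φ i) (hcs : Disjoint c s) :
    extend φ i s = insert i s :=
  if_pos ⟨c, hc, hcs⟩

theorem minimal_extend (hs : Minimal (IsTransversal (fixed φ i)) s) :
    Minimal (IsTransversal (fixed φ (i + 1))) (extend φ i s) := by
  by_cases hΔ : IsTransversal (delta φ i) s
  · rw [extend_of_isTransversal hΔ, fixed_succ]
    exact ⟨isTransversal_union.2 ⟨hs.prop, hΔ⟩, fun r hr hrs =>
      hs.le_of_le (isTransversal_union.1 hr).1 hrs⟩
  obtain ⟨d, hd, hds⟩ := not_not.1 (mt isTransversal_delta_iff.2 hΔ)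
  rw [extend_of_disjoint hd hds, minimal_isTransversal_iff, fixed_succ, isTransversal_union]
  refine ⟨⟨hs.prop.mono (Finset.subset_insert i s), fun c hc => ?_⟩, fun a ha => ?_⟩
  · exact ⟨i, Finset.mem_inter.2 ⟨(mem_delta.1 hc).2.1, Finset.mem_insert_self i s⟩⟩
  rcases Finset.mem_insert.1 ha with rfl | ha
  · refine ⟨d, Finset.mem_union_right _ hd, ?_⟩
    rw [Finset.inter_insert_of_mem (mem_delta.1 hd).2.1, Finset.disjoint_iff_inter_eq_empty.1 hds]
    rfl
  · obtain ⟨c, hc, hcs⟩ := (minimal_isTransversal_iff.1 hs).2 a ha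
    have hic : i ∉ c := fun h => ((mem_fixed.1 hc).2 i h).false
    exact ⟨c, Finset.mem_union_left _ hc, by rwa [Finset.inter_insert_of_notMem hic]⟩

theorem extend_truncate (ht : Minimal (IsTransversal (fixed φ (i + 1))) (truncate (i + 1) t)) :
    extend φ i (truncate i t) = truncate (i + 1) t := by
  by_cases hi : i ∈ t
  · rw [truncate_succ_of_mem hi] at ht ⊢
    obtain ⟨c, hc, hci⟩ := (minimal_isTransversal_iff.1 ht).2 i (Finset.mem_insert_self _ _)
    have hic : i ∈ c := (Finset.mem_inter.1 (hci ▸ Finset.mem_singleton_self i)).1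
    refine extend_of_disjoint (mem_delta.2 ⟨(mem_fixed.1 hc).1, hic, fun j hj =>
      Nat.lt_succ_iff.1 ((mem_fixed.1 hc).2 j hj)⟩) (Finset.disjoint_left.2 fun j hj hjt => ?_)
    have hji : j = i := Finset.mem_singleton.1
      (hci ▸ Finset.mem_inter.2 ⟨hj, Finset.mem_insert_of_mem hjt⟩)
    exact (mem_truncate.1 hjt).2.ne (congrArg Fin.val hji)
  · rw [truncate_succ_of_notMem hi] at ht ⊢
    exact extend_of_isTransversal (isTransversal_union.1 (fixed_succ φ i ▸ ht.prop)).2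

theorem truncate_extend (hki : k ≤ i) : truncate k (extend φ i s) = truncate k s := by
  rw [extend]
  split_ifs
  · rw [truncate, Finset.filter_insert, if_neg hki.not_gt]
    rfl
  · rfl

theorem foldl_finRange_induction {β : Type*} {g : β → Fin n → β} (P : ℕ → β → Prop) {b : β}
    (h0 : P 0 b) (hstep : ∀ (i : Fin n) b, P i b → P (i + 1) (g b i)) :
    P n ((List.finRange n).foldl g b) := by
  induction n with
  | zero => simpa using h0
  | succ n ih =>
    rw [List.finRange_succ_last, List.foldl_append, List.foldl_map]
    exact hstep (Fin.last n) _ (ih fun i b => hstep i.castSucc b)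

/-- The smallest completion of the term `s`, whose variables are among the first `k` ones: if `s` is
a prime implicant of `f_k`, then this is the smallest prime implicant `t*` of `f` with
`t*_k = s`. -/
def completion (φ : Finset (Finset (Fin n))) (k : ℕ) (s : Finset (Fin n)) : Finset (Fin n) :=
  (List.finRange n).foldl (fun s j => if k ≤ j.val then extend φ j s else s) s

theorem minimal_completion (hk : k ≤ n) (hs : Minimal (IsTransversal (fixed φ k)) s) :
    Minimal (IsTransversal φ) (completion φ k s) := by
  have := foldl_finRange_induction (g := fun s j => if k ≤ j.val then extend φ j s else s)
    (fun m s => Minimal (IsTransversal (fixed φ (max k m))) s) (by simpa using hs)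
    fun i s hs => by
      split_ifs with hki
      · rw [max_eq_right hki] at hs
        rw [max_eq_right (by omega)]
        exact minimal_extend hs
      · rwa [max_eq_left (by omega)] at hs ⊢
  rwa [max_eq_right hk, fixed_self] at this

theorem truncate_completion (φ : Finset (Finset (Fin n))) (k : ℕ) (s : Finset (Fin n)) :
    truncate k (completion φ k s) = truncate k s :=
  foldl_finRange_induction (fun _ u => truncate k u = truncate k s) rfl fun i u hu => by
    split_ifs with hki
    · rw [truncate_extend hki, hu]
    · exact hu

theorem mem_completion_iff_of_lt (hj : j.val < k) : j ∈ completion φ k s ↔ j ∈ s := by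
  have := congrArg (j ∈ ·) (truncate_completion φ k s)
  simpa only [mem_truncate, hj, and_true, eq_iff_iff] using this

theorem completion_truncate (hk : k ≤ n)
    (ht : ∀ m, k < m → m ≤ n → Minimal (IsTransversal (fixed φ m)) (truncate m t)) :
    completion φ k (truncate k t) = t := by
  have := foldl_finRange_induction (g := fun s j => if k ≤ j.val then extend φ j s else s)
    (b := truncate k t) (fun m s => s = truncate (max k m) t) (by simp) fun i s hs => by
      subst hs
      split_ifs with hki
      · rw [max_eq_right hki, max_eq_right (by omega)]
        exact extend_truncate (ht _ (by omega) (by omega))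
      · rw [max_eq_left (by omega), max_eq_left (by omega)]
  rwa [max_eq_right hk, truncate_self] at this

end Prefix

/-! ### The order of terms -/

section Weight

variable {s t : Finset (Fin n)}

theorem weight_eq_sum_map (t : Finset (Fin n)) :
    weight t = ∑ k ∈ t.map (Fin.revPerm.toEmbedding.trans Fin.valEmbedding), 2 ^ k := by
  rw [weight, Finset.sum_map]
  refine Finset.sum_congr rfl fun j _ => ?_
  simp [Nat.sub_sub, Nat.add_comm]

theorem weight_injective : Function.Injective (weight : Finset (Fin n) → ℕ) := by
  intro s t h
  rw [weight_eq_sum_map, weight_eq_sum_map] at h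
  exact Finset.map_injective _ (Finset.geomSum_injective le_rfl h)

theorem weight_lt_weight_iff :
    weight s < weight t ↔ ∃ j ∈ t, j ∉ s ∧ ∀ k ∈ s, k ∉ t → j < k := by
  rw [weight_eq_sum_map, weight_eq_sum_map,
    Finset.geomSum_lt_geomSum_iff_toColex_lt_toColex le_rfl,
    Finset.Colex.toColex_lt_toColex_iff_exists_forall_lt]
  have hmem : ∀ (r : Finset (Fin n)) (j : Fin n),
      j.rev.val ∈ r.map (Fin.revPerm.toEmbedding.trans Fin.valEmbedding) ↔ j ∈ r := fun r j =>
    Finset.mem_map' (Fin.revPerm.toEmbedding.trans Fin.valEmbedding)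
  constructor
  · rintro ⟨_, ha, has, hlt⟩
    obtain ⟨j, hj, rfl⟩ := Finset.mem_map.1 ha
    refine ⟨j, hj, fun h => has ((hmem s j).2 h), fun k hk hkt => Fin.rev_lt_rev.1 ?_⟩
    exact hlt k.rev ((hmem s k).2 hk) (mt (hmem t k).1 hkt)
  · rintro ⟨j, hj, hjs, hlt⟩
    refine ⟨j.rev, (hmem t j).2 hj, mt (hmem s j).1 hjs, fun b hb hbt => ?_⟩
    obtain ⟨k, hk, rfl⟩ := Finset.mem_map.1 hb
    exact Fin.rev_lt_rev.2 (hlt k hk fun h => hbt ((hmem t k).2 h))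

theorem weight_lt_weight_of_truncate_ssubset {k : ℕ} (h : truncate k s ⊂ truncate k t) :
    weight s < weight t := by
  obtain ⟨j, hjt, hjs⟩ := Finset.exists_of_ssubset h
  obtain ⟨hjt, hjk⟩ := mem_truncate.1 hjt
  refine weight_lt_weight_iff.2
    ⟨j, hjt, fun hj => hjs (mem_truncate.2 ⟨hj, hjk⟩), fun l hl hlt => ?_⟩
  refine Fin.lt_def.2 (hjk.trans_le (not_lt.1 fun hlk => hlt ?_))
  exact (mem_truncate.1 (h.1 (mem_truncate.2 ⟨hl, hlk⟩))).1

end Weight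

/-! ### Generation of prime implicants -/

section Generation

variable {φ : Finset (Finset (Fin n))} {r s t u w : Finset (Fin n)} {i j : Fin n}

theorem residual_eq_image (φ : Finset (Finset (Fin n))) (i : Fin n) (t : Finset (Fin n)) :
    residual φ i t =
      ({c ∈ delta φ i | Disjoint c (truncate i t)} : Finset _).image (·.erase i) := by
  have hi : i ∉ truncate i t := fun h => (mem_truncate.1 h).2.false
  rw [residual, Finset.filter_image]
  congr 1
  refine Finset.filter_congr fun c _ => ?_
  change Disjoint (c.erase i) (truncate i t) ↔ _
  rw [Finset.disjoint_erase_comm, Finset.erase_eq_of_notMem hi]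

theorem residual_nonempty_iff :
    (residual φ i t).Nonempty ↔ ∃ c ∈ delta φ i, Disjoint c (truncate i t) := by
  rw [residual_eq_image, Finset.image_nonempty, Finset.filter_nonempty_iff]

theorem mem_rho_iff : r ∈ rho φ t i ↔
    i ∉ r ∧ Minimal (IsTransversal {c ∈ delta φ i | Disjoint c (truncate i t)}) r := by
  rw [rho, mem_primeImplicants_cnfFun, residual_eq_image, minimal_isTransversal_image_erase]

theorem lt_of_mem_rho (hr : r ∈ rho φ t i) (hj : j ∈ r) : j < i := by
  obtain ⟨hi, hmin⟩ := mem_rho_iff.1 hr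
  obtain ⟨c, hc, hcr⟩ := (minimal_isTransversal_iff.1 hmin).2 j hj
  have hjc := (Finset.mem_inter.1 (hcr ▸ Finset.mem_singleton_self j)).1
  exact ((mem_delta.1 (Finset.mem_filter.1 hc).1).2.2 j hjc).lt_of_ne (ne_of_mem_of_not_mem hj hi)

theorem notMem_of_mem_rho (hr : r ∈ rho φ t i) (hj : j ∈ r) : j ∉ t := fun hjt => by
  obtain ⟨c, hc, hcr⟩ := (minimal_isTransversal_iff.1 (mem_rho_iff.1 hr).2).2 j hj
  have hjc := (Finset.mem_inter.1 (hcr ▸ Finset.mem_singleton_self j)).1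
  exact Finset.disjoint_left.1 (Finset.mem_filter.1 hc).2 hjc
    (mem_truncate.2 ⟨hjt, lt_of_mem_rho hr hj⟩)

/-- In the pass for the term `t`, the term `u` is put into the queue when `x_i` is treated. -/
def GeneratesVia (φ : Finset (Finset (Fin n))) (t : Finset (Fin n)) (i : Fin n)
    (u : Finset (Fin n)) : Prop :=
  (residual φ i t).Nonempty ∧ ∃ r ∈ rho φ t i,
    Minimal (IsTransversal (fixed φ (i + 1))) (truncate i t ∪ r) ∧
      completion φ (i + 1) (truncate i t ∪ r) = u

/-- The term `u` is put into the queue in the pass for the term `t`. -/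
def Generates (φ : Finset (Finset (Fin n))) (t u : Finset (Fin n)) : Prop :=
  ∃ i ∈ t, GeneratesVia φ t i u

theorem Generates.minimal (h : Generates φ t u) : Minimal (IsTransversal φ) u := by
  obtain ⟨i, -, -, r, -, hmin, rfl⟩ := h
  exact minimal_completion i.isLt hmin

theorem Generates.weight_lt (h : Generates φ t u) : weight t < weight u := by
  obtain ⟨i, -, hΔ, r, hr, -, rfl⟩ := h
  obtain ⟨c, hc, hct⟩ := residual_nonempty_iff.1 hΔ
  obtain ⟨j, hj⟩ := (mem_rho_iff.1 hr).2.prop c (Finset.mem_filter.2 ⟨hc, hct⟩)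
  have hjr : j ∈ r := (Finset.mem_inter.1 hj).2
  have hji : j.val < i := lt_of_mem_rho hr hjr
  have hmem : ∀ {k : Fin n}, k.val < i → k ∈ truncate i t ∪ r →
      k ∈ truncate i (completion φ (i + 1) (truncate i t ∪ r)) := fun hk hkw =>
    mem_truncate.2 ⟨(mem_completion_iff_of_lt (Nat.lt_succ_of_lt hk)).2 hkw, hk⟩
  refine weight_lt_weight_of_truncate_ssubset (k := i) (Finset.ssubset_iff_of_subset ?_ |>.2 ?_)
  · exact fun k hk => hmem (mem_truncate.1 hk).2 (Finset.mem_union_left _ hk)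
  · exact ⟨j, hmem hji (Finset.mem_union_right _ hjr), fun h =>
      notMem_of_mem_rho hr hjr (mem_truncate.1 h).1⟩

theorem minimal_truncate_of_mem (hi : i ∈ t)
    (ht : Minimal (IsTransversal (fixed φ (i + 1))) (truncate (i + 1) t)) :
    Minimal (IsTransversal (fixed φ i)) (truncate i t) := by
  rw [truncate_succ_of_mem hi, minimal_isTransversal_iff, fixed_succ, isTransversal_union] at ht
  have hinter : ∀ {c}, i ∉ c → c ∩ insert i (truncate i t) = c ∩ truncate i t :=
    Finset.inter_insert_of_notMem
  refine minimal_isTransversal_iff.2 ⟨fun c hc => ?_, fun a ha => ?_⟩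
  · exact hinter (fun h => ((mem_fixed.1 hc).2 i h).false) ▸ ht.1.1 c hc
  · obtain ⟨c, hc, hca⟩ := ht.2 a (Finset.mem_insert_of_mem ha)
    have hic : i ∉ c := fun h => (mem_truncate.1 ha).2.ne' <| congrArg Fin.val <|
      Finset.mem_singleton.1 (hca ▸ Finset.mem_inter.2 ⟨h, Finset.mem_insert_self i _⟩)
    refine ⟨c, (Finset.mem_union.1 hc).resolve_right fun h => hic (mem_delta.1 h).2.1, ?_⟩
    rw [← hinter hic, hca]

theorem truncate_completion_insert (hs : ∀ j ∈ s, j.val < i) :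
    truncate i (completion φ (i + 1) (insert i s)) = s := by
  ext j
  rw [mem_truncate]
  refine ⟨fun ⟨hju, hji⟩ => ?_, fun hj => ?_⟩
  · have hj := (mem_completion_iff_of_lt (Nat.lt_succ_of_lt hji)).1 hju
    exact (Finset.mem_insert.1 hj).resolve_left fun h => hji.ne (congrArg Fin.val h)
  · have hji := Nat.lt_succ_of_lt (hs j hj)
    exact ⟨(mem_completion_iff_of_lt hji).2 (Finset.mem_insert_of_mem hj), hs j hj⟩

theorem exists_generatesVia_of_not_minimal (hw : Minimal (IsTransversal (fixed φ (i + 1))) w)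
    (hiw : i ∉ w) (hnot : ¬ Minimal (IsTransversal (fixed φ i)) w) :
    ∃ u, Minimal (IsTransversal φ) u ∧ i ∈ u ∧ GeneratesVia φ u i (completion φ (i + 1) w) := by
  obtain ⟨s, hsw, hs⟩ :=
    (isTransversal_union.1 (fixed_succ φ i ▸ hw.prop)).1.exists_minimal_subset
  have hsw' : s ⊂ w := hsw.ssubset_of_ne fun h => hnot (h ▸ hs)
  obtain ⟨d, hd, hds⟩ : ∃ c ∈ delta φ i, Disjoint c s := by
    by_contra h
    refine hw.not_prop_of_lt hsw' ?_
    rw [fixed_succ]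
    exact isTransversal_union.2 ⟨hs.prop, isTransversal_delta_iff.2 h⟩
  have hmin := minimal_extend hs
  rw [extend_of_disjoint hd hds] at hmin
  let u := completion φ (i + 1) (insert i s)
  have hu : truncate i u = s :=
    truncate_completion_insert fun j => lt_of_mem_of_minimal_fixed hs
  have hfilter : ({c ∈ fixed φ (i + 1) | Disjoint c s} : Finset _) =
      {c ∈ delta φ i | Disjoint c s} := by
    rw [fixed_succ, Finset.filter_union, Finset.filter_eq_empty_iff.2, Finset.empty_union]
    exact fun c hc => Finset.not_disjoint_iff_nonempty_inter.2 (hs.prop c hc)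
  refine ⟨u, minimal_completion i.isLt hmin,
    (mem_completion_iff_of_lt (Nat.lt_succ_self i)).2 (Finset.mem_insert_self i s),
    residual_nonempty_iff.2 ⟨d, hd, hu.symm ▸ hds⟩, w \ s, ?_, ?_, ?_⟩
  · rw [mem_rho_iff, hu, ← hfilter]
    exact ⟨fun h => hiw (Finset.mem_sdiff.1 h).1, minimal_isTransversal_sdiff hw hsw⟩
  · rwa [hu, Finset.union_sdiff_of_subset hsw]
  · rw [hu, Finset.union_sdiff_of_subset hsw]

theorem eq_completion_or_exists_generates (ht : Minimal (IsTransversal φ) t) :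
    completion φ 0 ∅ = t ∨ ∃ s, Minimal (IsTransversal φ) s ∧ Generates φ s t := by
  classical
  let P : ℕ → Prop := fun m => ¬ Minimal (IsTransversal (fixed φ m)) (truncate m t)
  by_cases hall : ∀ m ≤ n, ¬ P m
  · left
    rw [← truncate_zero (t := t)]
    exact completion_truncate (Nat.zero_le n) fun m _ hm => not_not.1 (hall m hm)
  right
  push Not at hall
  obtain ⟨m₀, hm₀, hbad₀⟩ := hall
  have hbad : P (Nat.findGreatest P n) := Nat.findGreatest_spec hm₀ hbad₀
  have hgood : ∀ k, Nat.findGreatest P n < k → k ≤ n → ¬ P k := fun k =>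
    Nat.findGreatest_is_greatest
  have hle : Nat.findGreatest P n ≤ n := Nat.findGreatest_le n
  generalize Nat.findGreatest P n = m at hbad hgood hle
  have hmn : m < n := hle.lt_of_ne <| by
    rintro rfl
    exact hbad (by rwa [truncate_self, fixed_self])
  obtain ⟨i, rfl⟩ : ∃ i : Fin n, i.val = m := ⟨⟨m, hmn⟩, rfl⟩
  have hmin := not_not.1 (hgood (i + 1) (Nat.lt_succ_self i) hmn)
  have hi : i ∉ t := fun hi => hbad (minimal_truncate_of_mem hi hmin)
  obtain ⟨u, hu, hiu, hgen⟩ := exists_generatesVia_of_not_minimal hmin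
    (fun h => hi (mem_truncate.1 h).1) (by rwa [truncate_succ_of_notMem hi])
  rw [completion_truncate hmn fun k hk hkn => not_not.1 (hgood k (Nat.lt_of_succ_lt hk) hkn)]
    at hgen
  exact ⟨u, hu, i, hiu, hgen⟩

theorem isTransversal_of_mem_rho (ht : IsTransversal φ t) (hr : r ∈ rho φ t i) :
    IsTransversal φ (truncate i t ∪ r ∪ ({j | i < j} : Finset (Fin n))) := by
  have hi : IsTransversal (fixed φ (i + 1)) (truncate i t ∪ r) := by
    refine fixed_succ φ i ▸ isTransversal_union.2 ⟨?_, fun c hc => ?_⟩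
    · exact (isTransversal_fixed_truncate.2 (ht.anti (Finset.filter_subset _ _))).mono
        Finset.subset_union_left
    · by_cases hct : Disjoint c (truncate i t)
      · exact ((mem_rho_iff.1 hr).2.prop c (Finset.mem_filter.2 ⟨hc, hct⟩)).mono
          (Finset.inter_subset_inter_left Finset.subset_union_right)
      · exact (Finset.not_disjoint_iff_nonempty_inter.1 hct).mono
          (Finset.inter_subset_inter_left Finset.subset_union_left)
  intro c hc
  by_cases hci : ∃ j ∈ c, i < j
  · obtain ⟨j, hj, hij⟩ := hci
    exact ⟨j, by simp [hj, hij]⟩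
  · push Not at hci
    exact (hi.mono Finset.subset_union_left) c
      (mem_fixed.2 ⟨hc, fun j hj => Nat.lt_succ_of_le (hci j hj)⟩)

theorem exists_minimal_truncate_sdiff_eq (ht : IsTransversal φ t) (hr : r ∈ rho φ t i) :
    ∃ u, Minimal (IsTransversal φ) u ∧ truncate i u \ t = r := by
  obtain ⟨u, hsub, hu⟩ := (isTransversal_of_mem_rho ht hr).exists_minimal_subset
  have hmem : ∀ j ∈ u, j ∈ t ∧ j < i ∨ j ∈ r ∨ i < j := fun j hj => by
    simpa [mem_truncate] using hsub hj
  obtain ⟨hir, hmin⟩ := mem_rho_iff.1 hr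
  have hur : truncate i u \ t ⊆ r := fun j hj => by
    obtain ⟨hj, hjt⟩ := Finset.mem_sdiff.1 hj
    obtain ⟨hju, hji⟩ := mem_truncate.1 hj
    exact ((hmem j hju).resolve_left fun h => hjt h.1).resolve_right hji.not_gt
  refine ⟨u, hu, hur.antisymm (hmin.le_of_le (fun c hc => ?_) hur)⟩
  obtain ⟨hcΔ, hct⟩ := Finset.mem_filter.1 hc
  obtain ⟨hcφ, -, hle⟩ := mem_delta.1 hcΔ
  obtain ⟨j, hj⟩ := hu.prop c hcφ
  obtain ⟨hjc, hju⟩ := Finset.mem_inter.1 hj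
  have hji : j < i := (hle j hjc).lt_of_ne <| by
    rintro rfl
    simpa [hir] using hmem j hju
  have hjt : j ∉ t := fun h => Finset.disjoint_left.1 hct hjc (mem_truncate.2 ⟨h, hji⟩)
  exact ⟨j, by simp [hjc, hju, mem_truncate, hjt, Fin.lt_def.1 hji]⟩

theorem card_rho_le (ht : IsTransversal φ t) (i : Fin n) :
    (rho φ t i).card ≤ (primeImplicants (cnfFun φ)).card := by
  choose! u hu hur using fun r (hr : r ∈ rho φ t i) => exists_minimal_truncate_sdiff_eq ht hr
  exact Finset.card_le_card_of_injOn u (fun r hr => mem_primeImplicants_cnfFun.2 (hu r hr))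
    (Set.LeftInvOn.injOn (f₁' := fun v => truncate i v \ t) hur)

end Generation

/-! ### The cost model -/

section Timed

variable {α β : Type}

@[simp] theorem Timed.val_pure (a : α) : (pure a : Timed α).val = a := rfl

@[simp] theorem Timed.time_pure (a : α) : (pure a : Timed α).time = 0 := rfl

@[simp] theorem Timed.val_bind (x : Timed α) (g : α → Timed β) :
    (x >>= g).val = (g x.val).val := rfl

@[simp] theorem Timed.time_bind (x : Timed α) (g : α → Timed β) :
    (x >>= g).time = x.time + (g x.val).time := rfl

@[simp] theorem time_charge (k : ℕ) : (charge k).time = k := rfl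

@[simp] theorem Arr.val_new (a : α) : (Arr.new n a).val = fun _ => a := rfl

@[simp] theorem Arr.time_new (a : α) : (Arr.new n a).time = n + 1 := rfl

@[simp] theorem Arr.val_get (A : Arr n α) (j : Fin n) : (A.get j).val = A j := rfl

@[simp] theorem Arr.time_get (A : Arr n α) (j : Fin n) : (A.get j).time = 1 := rfl

@[simp] theorem Arr.val_set (A : Arr n α) (j : Fin n) (a : α) :
    (A.set j a).val = Function.update A j a := rfl

@[simp] theorem Arr.time_set (A : Arr n α) (j : Fin n) (a : α) : (A.set j a).time = 1 := rfl

variable {g : β → α → Timed β} {b : β} {l : List α}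

theorem loop_val (g : β → α → Timed β) (b : β) (l : List α) :
    (loop g b l).val = l.foldl (fun b a => (g b a).val) b := by
  induction l generalizing b with
  | nil => rfl
  | cons a l ih => simp [loop, ih]

theorem loop_time_le (τ : α → ℕ) (hτ : ∀ b, ∀ a ∈ l, (g b a).time ≤ τ a) :
    (loop g b l).time ≤ 1 + (l.map fun a => 1 + τ a).sum := by
  induction l generalizing b with
  | nil => simp [loop]
  | cons a l ih =>
    have hhead := hτ b a List.mem_cons_self
    have htail := ih (b := (g b a).val) fun b a ha => hτ b a (List.mem_cons_of_mem _ ha)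
    simp only [loop, Timed.time_bind, time_charge, List.map_cons, List.sum_cons]
    omega

theorem loop_time_le_length_mul (k : ℕ) (hk : ∀ b, ∀ a ∈ l, (g b a).time ≤ k) :
    (loop g b l).time ≤ 1 + l.length * (1 + k) := by
  simpa using loop_time_le (fun _ => k) hk (b := b)

theorem loop_finRange_time_le {g : β → Fin n → Timed β} (k : ℕ) (τ : Fin n → ℕ)
    (hτ : ∀ b i, (g b i).time ≤ k + τ i) :
    (loop g b (List.finRange n)).time ≤ 1 + n * (1 + k) + ∑ i, τ i := by
  refine (loop_time_le (fun i => k + τ i) fun b i _ => hτ b i).trans_eq ?_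
  rw [← Fin.sum_univ_def, Finset.sum_add_distrib, Finset.sum_add_distrib]
  simp only [Finset.sum_const, Finset.card_univ, Fintype.card_fin, smul_eq_mul]
  ring

/-- The number of memory cells of a list of clauses: one for each clause and one for each literal,
so that the running times of nested loops are linear in it. -/
def cells (L : List (List α)) : ℕ := (L.map fun c => 1 + c.length).sum

theorem loop_time_le_mul_cells {g : β → List α → Timed β} {L : List (List α)} (k : ℕ)
    (hk : ∀ b, ∀ c ∈ L, 1 + (g b c).time ≤ k * (1 + c.length)) :
    (loop g b L).time ≤ 1 + k * cells L := by
  refine (loop_time_le (fun c => k * (1 + c.length) - 1) fun b c hc => ?_).trans ?_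
  · exact Nat.le_sub_of_add_le' (hk b c hc)
  · rw [cells, ← List.sum_map_mul_left]
    exact Nat.add_le_add_left (List.sum_le_sum fun c hc => by have := hk b c hc; omega) 1

end Timed

/-! ### The queue -/

theorem mem_support {A : Arr n Bool} {j : Fin n} : j ∈ support A ↔ A j = true := by
  simp [support]

theorem support_update_true (A : Arr n Bool) (j : Fin n) :
    support (Function.update A j true) = insert j (support A) := by
  ext k
  by_cases hk : k = j <;> simp [mem_support, hk]

namespace Tree

/-- The terms stored in a tree whose levels correspond to the listed variables. -/
def terms : List (Fin n) → Tree → Set (Finset (Fin n))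
  | [], .leaf => {∅}
  | j :: js, .node l r => Insert.insert j '' terms js l ∪ terms js r
  | _, _ => ∅

/-- All leaves are at the depth given by the listed variables, and no node has two empty sons. -/
def WF : List (Fin n) → Tree → Prop
  | _, .empty => True
  | [], .leaf => True
  | _ :: js, .node l r => WF js l ∧ WF js r ∧ ¬ (l = .empty ∧ r = .empty)
  | _, _ => False

variable {A : Arr n Bool} {j : Fin n} {js : List (Fin n)} {l r Q : Tree} {t : Finset (Fin n)}

@[simp] theorem terms_empty (js : List (Fin n)) : terms js .empty = ∅ := by
  cases js <;> rfl

@[simp] theorem wf_empty (js : List (Fin n)) : WF js .empty := by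
  cases js <;> trivial

theorem subset_of_mem_terms (ht : t ∈ terms js Q) : ∀ k ∈ t, k ∈ js := by
  induction js generalizing Q t with
  | nil => cases Q <;> simp_all [terms]
  | cons j js ih =>
    cases Q with
    | empty => simp at ht
    | leaf => simp [terms] at ht
    | node l r =>
      rcases ht with ⟨s, hs, rfl⟩ | ht
      · simpa using fun k hk => Or.inr (ih hs k hk)
      · exact fun k hk => List.mem_cons_of_mem _ (ih ht k hk)

theorem insert_ne_empty (A : Arr n Bool) (js : List (Fin n)) (Q : Tree) :
    (Tree.insert A js Q).val ≠ .empty := by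
  cases js with
  | nil => simp [Tree.insert]
  | cons j js => cases Q <;> by_cases h : A j <;> simp [Tree.insert, h]

theorem wf_insert (A : Arr n Bool) (hQ : WF js Q) : WF js (Tree.insert A js Q).val := by
  induction js generalizing Q with
  | nil => simp [Tree.insert, WF]
  | cons j js ih =>
    have hne := insert_ne_empty A js
    cases Q with
    | empty => by_cases h : A j <;> simp [Tree.insert, h, WF, hne, ih]
    | leaf => simp [WF] at hQ
    | node l r =>
      obtain ⟨hl, hr, -⟩ := hQ
      by_cases h : A j <;> simp [Tree.insert, h, WF, hne, ih, hl, hr]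

theorem terms_insert (A : Arr n Bool) (hQ : WF js Q) :
    terms js (Tree.insert A js Q).val = Insert.insert (support A ∩ js.toFinset) (terms js Q) := by
  induction js generalizing Q with
  | nil => cases Q <;> simp_all [Tree.insert, terms, WF]
  | cons j js ih =>
    have hinter : support A ∩ (j :: js).toFinset =
        if A j then Insert.insert j (support A ∩ js.toFinset) else support A ∩ js.toFinset := by
      split_ifs with h <;> rw [List.toFinset_cons]
      · exact Finset.inter_insert_of_mem (mem_support.2 h)
      · exact Finset.inter_insert_of_notMem (mt mem_support.1 h)
    rw [hinter]
    cases Q with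
    | empty => by_cases h : A j <;> simp [Tree.insert, h, terms, ih (wf_empty js)]
    | leaf => simp [WF] at hQ
    | node l r =>
      obtain ⟨hl, hr, -⟩ := hQ
      by_cases h : A j
      · simp [Tree.insert, h, terms, ih hl, Set.image_insert_eq, Set.insert_union]
      · simp [Tree.insert, h, terms, ih hr, Set.union_insert]

theorem insert_time_le (A : Arr n Bool) (js : List (Fin n)) (Q : Tree) :
    (Tree.insert A js Q).time ≤ 2 * js.length + 1 := by
  induction js generalizing Q with
  | nil => simp [Tree.insert]
  | cons j js ih =>
    cases Q with
    | node l r =>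
      have := ih l
      have := ih r
      by_cases h : A j <;> simp [Tree.insert, h] <;> omega
    | _ =>
      have := ih .empty
      by_cases h : A j <;> simp [Tree.insert, h] <;> omega

theorem mk_of_not_and (h : ¬ (l = .empty ∧ r = .empty)) : Tree.mk l r = .node l r := by
  cases l <;> cases r <;> simp_all [Tree.mk]

theorem wf_mk (hl : WF js l) (hr : WF js r) : WF (j :: js) (Tree.mk l r) := by
  by_cases h : l = .empty ∧ r = .empty
  · obtain ⟨rfl, rfl⟩ := h
    exact wf_empty _
  · rw [mk_of_not_and h]
    exact ⟨hl, hr, h⟩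

theorem terms_mk (j : Fin n) (js : List (Fin n)) (l r : Tree) :
    terms (j :: js) (Tree.mk l r) = Insert.insert j '' terms js l ∪ terms js r := by
  by_cases h : l = .empty ∧ r = .empty
  · obtain ⟨rfl, rfl⟩ := h
    simp [Tree.mk]
  · rw [mk_of_not_and h]
    rfl

theorem popMin_time_le (js : List (Fin n)) (Q : Tree) (A : Arr n Bool) :
    (Tree.popMin js Q A).time ≤ 2 * js.length + 1 := by
  induction js generalizing Q A with
  | nil => simp [Tree.popMin]
  | cons j js ih =>
    cases Q with
    | empty => simp [Tree.popMin]
    | leaf => simp [Tree.popMin]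
    | node l r =>
      cases r with
      | empty =>
        have := ih l (Function.update A j true)
        simp only [Tree.popMin, Timed.time_bind, time_charge, Arr.time_set, Arr.val_set,
          Timed.time_pure, List.length_cons]
        omega
      | leaf =>
        have := ih .leaf A
        simp only [Tree.popMin, Timed.time_bind, time_charge, Timed.time_pure, List.length_cons]
        omega
      | node r₁ r₂ =>
        have := ih (.node r₁ r₂) A
        simp only [Tree.popMin, Timed.time_bind, time_charge, Timed.time_pure, List.length_cons]
        omega

theorem popMin_node_empty (A : Arr n Bool) (j : Fin n) (js : List (Fin n)) (l : Tree) :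
    (Tree.popMin (j :: js) (.node l .empty) A).val =
      ((Tree.popMin js l (Function.update A j true)).val.1,
        Tree.mk (Tree.popMin js l (Function.update A j true)).val.2 .empty) := rfl

theorem popMin_node_of_ne_empty (A : Arr n Bool) (j : Fin n) (js : List (Fin n)) (l : Tree)
    (hr : r ≠ .empty) :
    (Tree.popMin (j :: js) (.node l r) A).val =
      ((Tree.popMin js r A).val.1, Tree.mk l (Tree.popMin js r A).val.2) := by
  cases r with
  | empty => exact absurd rfl hr
  | leaf => rfl
  | node => rfl

/-- The term `m` is the smallest one in the tree `Q`, and `Q'` is what remains without it. -/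
structure IsPopMin (js : List (Fin n)) (Q : Tree) (m : Finset (Fin n)) (Q' : Tree) : Prop where
  mem : m ∈ terms js Q
  weight_le : ∀ x ∈ terms js Q, weight m ≤ weight x
  terms_eq : terms js Q' = terms js Q \ {m}
  wf : WF js Q'

theorem IsPopMin.left {m : Finset (Fin n)} {l' : Tree} (hjs : j ∉ js) (h : IsPopMin js l m l') :
    IsPopMin (j :: js) (.node l .empty) (Insert.insert j m) (Tree.mk l' .empty) := by
  have hnotMem : ∀ x ∈ terms js l, j ∉ x := fun x hx hj => hjs (subset_of_mem_terms hx j hj)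
  have hterms : terms (j :: js) (.node l .empty) = Insert.insert j '' terms js l := by simp [terms]
  refine ⟨hterms ▸ Set.mem_image_of_mem _ h.mem, ?_, ?_, wf_mk h.wf (wf_empty js)⟩
  · rw [hterms, Set.forall_mem_image]
    intro x hx
    rw [weight, weight, Finset.sum_insert (hnotMem m h.mem), Finset.sum_insert (hnotMem x hx)]
    exact Nat.add_le_add_left (h.weight_le x hx) _
  · have hinj : Set.InjOn (Insert.insert j) (terms js l) := fun x hx y hy hxy => by
      rw [← Finset.erase_insert (hnotMem x hx), hxy, Finset.erase_insert (hnotMem y hy)]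
    rw [terms_mk, h.terms_eq, terms_empty, Set.union_empty, hterms, ← Set.image_singleton,
      hinj.image_sdiff_subset (Set.singleton_subset_iff.2 h.mem)]

theorem IsPopMin.right {m : Finset (Fin n)} {r' : Tree} (hjs : ∀ k ∈ js, j < k) (hl : WF js l)
    (h : IsPopMin js r m r') : IsPopMin (j :: js) (.node l r) m (Tree.mk l r') := by
  have hm : ∀ k ∈ m, j < k := fun k hk => hjs k (subset_of_mem_terms h.mem k hk)
  have hjm : j ∉ m := fun hj => (hm j hj).false
  refine ⟨Or.inr h.mem, ?_, ?_, wf_mk hl h.wf⟩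
  · rintro x (⟨y, -, rfl⟩ | hx)
    · exact (weight_lt_weight_iff.2 ⟨j, Finset.mem_insert_self j y, hjm, fun k hk _ => hm k hk⟩).le
    · exact h.weight_le x hx
  · have hleft : m ∉ Insert.insert j '' terms js l := by
      rintro ⟨y, -, rfl⟩
      exact hjm (Finset.mem_insert_self j y)
    rw [terms_mk, h.terms_eq, terms, Set.union_sdiff_distrib, Set.sdiff_singleton_eq_self hleft]

theorem exists_isPopMin_popMin (hjs : js.Pairwise (· < ·)) (hQ : WF js Q) (hne : Q ≠ .empty)
    (A : Arr n Bool) : ∃ m, support (Tree.popMin js Q A).val.1 = m ∪ support A ∧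
      IsPopMin js Q m (Tree.popMin js Q A).val.2 := by
  induction js generalizing Q A with
  | nil =>
    cases Q with
    | empty => exact absurd rfl hne
    | leaf => exact ⟨∅, by simp [Tree.popMin], by simp [terms], by simp [terms],
        by simp [Tree.popMin, terms], by simp [Tree.popMin]⟩
    | node l r => simp [WF] at hQ
  | cons j js ih =>
    rw [List.pairwise_cons] at hjs
    cases Q with
    | empty => exact absurd rfl hne
    | leaf => simp [WF] at hQ
    | node l r =>
      obtain ⟨hl, hr, hlr⟩ := hQ
      by_cases hre : r = .empty
      · subst hre
        obtain ⟨m, hsupp, hm⟩ := ih hjs.2 hl (fun h => hlr ⟨h, rfl⟩) (Function.update A j true)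
        rw [popMin_node_empty]
        refine ⟨Insert.insert j m, ?_, hm.left fun h => (hjs.1 j h).false⟩
        rw [hsupp, support_update_true, Finset.union_insert, Finset.insert_union]
      · obtain ⟨m, hsupp, hm⟩ := ih hjs.2 hr hre A
        rw [popMin_node_of_ne_empty A j js l hre]
        exact ⟨m, hsupp, hm.right hjs.1 hl⟩

end Tree

/-! ### Lists of clauses -/

section Represents

variable {L L' : List (List (Fin n))} {φ : Finset (Finset (Fin n))} {c : List (Fin n)}
  {d : Finset (Fin n)} {A : Arr n Bool}

theorem Represents.mem_iff (h : Represents L φ) : d ∈ φ ↔ ∃ c ∈ L, c.toFinset = d := by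
  rw [← h.2.2, List.mem_toFinset, List.mem_map]

theorem Represents.mem (h : Represents L φ) (hc : c ∈ L) : c.toFinset ∈ φ :=
  h.mem_iff.2 ⟨c, hc, rfl⟩

theorem Represents.length_eq_card (h : Represents L φ) : L.length = φ.card := by
  rw [← h.2.2, List.toFinset_card_of_nodup h.1, List.length_map]

theorem Represents.reverse (h : Represents L φ) : Represents L.reverse φ := by
  simpa [Represents, List.map_reverse] using h

theorem Represents.filter {p : List (Fin n) → Bool} {P : Finset (Fin n) → Prop} [DecidablePred P]
    (h : Represents L φ) (hp : ∀ c ∈ L, p c = true ↔ P c.toFinset) :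
    Represents (L.filter p) {d ∈ φ | P d} := by
  refine ⟨h.1.sublist (List.filter_sublist.map _), fun c hc => h.2.1 c (List.mem_of_mem_filter hc),
    ?_⟩
  ext d
  simp only [List.mem_toFinset, List.mem_map, List.mem_filter, Finset.mem_filter, h.mem_iff]
  grind

theorem Represents.map {e : List (Fin n) → List (Fin n)} {E : Finset (Fin n) → Finset (Fin n)}
    (h : Represents L φ) (he : ∀ c ∈ L, (e c).Nodup) (heE : ∀ c ∈ L, (e c).toFinset = E c.toFinset)
    (hE : Set.InjOn E φ) : Represents (L.map e) (φ.image E) := by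
  have hmap : (L.map e).map List.toFinset = (L.map List.toFinset).map E := by
    simpa using heE
  refine ⟨?_, by simpa using he, ?_⟩
  · rw [hmap]
    refine h.1.map_on fun d hd d' hd' => hE ?_ ?_ <;> rwa [← h.2.2, List.coe_toFinset]
  · ext d
    simp [hmap, h.mem_iff]

theorem Represents.length_eq_sum (h : Represents L φ) :
    length φ = (L.map List.length).sum := by
  rw [length, ← h.2.2, List.sum_toFinset _ h.1, List.map_map]
  exact congrArg _ (List.map_congr_left fun c hc => List.toFinset_card_of_nodup (h.2.1 c hc))

theorem Represents.cells_le (h : Represents L φ) (hφ : ∅ ∉ φ) : cells L ≤ 2 * length φ := by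
  rw [h.length_eq_sum, cells, ← List.sum_map_mul_left]
  refine List.sum_le_sum fun c hc => ?_
  have hpos : 0 < c.length := List.length_pos_iff.2 fun hnil => hφ (by simpa [hnil] using h.mem hc)
  omega

theorem foldl_or {α : Type*} (f : α → Bool) (b : Bool) (l : List α) :
    l.foldl (fun b a => b || f a) b = (b || l.any f) := by
  induction l generalizing b with
  | nil => simp
  | cons a l ih => simp [ih, Bool.or_assoc]

theorem foldl_ite_cons {α β : Type*} (p : α → Bool) (f : α → β) (l : List α) (Γ : List β) :
    l.foldl (fun Γ a => if p a then f a :: Γ else Γ) Γ = ((l.filter p).map f).reverse ++ Γ := by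
  induction l generalizing Γ with
  | nil => simp
  | cons a l ih => by_cases h : p a <;> simp [ih, h]

theorem not_any_iff_disjoint : (!c.any A) = true ↔ Disjoint c.toFinset (support A) := by
  simp [Finset.disjoint_left, mem_support]

end Represents

/-! ### Preprocessing -/

section Buckets

variable {L : List (List (Fin n))} {φ : Finset (Finset (Fin n))}

theorem lastVar_val (c : List (Fin n)) : (lastVar c).val = c.max? := by
  rw [lastVar, loop_val]
  cases c with
  | nil => rfl
  | cons a c =>
    change c.foldl _ (some a) = some (c.foldl max a)
    induction c generalizing a with
    | nil => rfl
    | cons b c ih => simpa only [List.foldl_cons, max_def_lt, Timed.val_pure] using ih (max a b)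

theorem lastVar_time_le (c : List (Fin n)) : (lastVar c).time ≤ 1 + c.length := by
  refine (loop_time_le_length_mul 0 ?_).trans_eq (by simp)
  rintro (_ | _) _ _ <;> simp

/-- The treatment of one clause in `buckets`. -/
def addToBucket (B : Arr n (List (List (Fin n)))) (c : List (Fin n)) :
    Timed (Arr n (List (List (Fin n)))) := do
  match ← lastVar c with
  | none => return B
  | some i =>
      let l ← B.get i
      B.set i (c :: l)

theorem buckets_eq (L : List (List (Fin n))) :
    buckets L = (do
      let B ← Arr.new n []
      loop addToBucket B L) := rfl

theorem addToBucket_val (B : Arr n (List (List (Fin n)))) (c : List (Fin n)) (i : Fin n) :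
    (addToBucket B c).val i = if c.max? = some i then c :: B i else B i := by
  rw [addToBucket, Timed.val_bind, lastVar_val]
  rcases c.max? with _ | j
  · simp
  · by_cases hij : i = j
    · subst hij
      simp
    · simp [hij, Ne.symm hij]

theorem addToBucket_time_le (B : Arr n (List (List (Fin n)))) (c : List (Fin n)) :
    (addToBucket B c).time ≤ 3 + c.length := by
  have := lastVar_time_le c
  rw [addToBucket, Timed.time_bind]
  rcases (lastVar c).val with _ | j <;> simp <;> omega

theorem buckets_val (L : List (List (Fin n))) (i : Fin n) :
    (buckets L).val i = (L.filter fun c => c.max? = some i).reverse := by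
  have hfold := List.foldl_hom (· i) (g₁ := fun B c => (addToBucket B c).val)
    (g₂ := fun l c => if c.max? = some i then c :: l else l) (l := L) (init := fun _ => [])
    fun B c => (addToBucket_val B c i).symm
  have hlist := foldl_ite_cons (fun c : List (Fin n) => decide (c.max? = some i)) id L []
  simp only [decide_eq_true_eq, id, List.map_id_fun, List.append_nil] at hlist
  rw [buckets_eq, Timed.val_bind, loop_val]
  exact hfold.symm.trans hlist

theorem buckets_time_le (L : List (List (Fin n))) : (buckets L).time ≤ n + 2 + 4 * cells L := by
  have hloop := loop_time_le_mul_cells (L := L) (b := fun _ => []) (g := addToBucket) 4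
    fun B c _ => by have := addToBucket_time_le B c; omega
  rw [buckets_eq, Timed.time_bind, Arr.time_new, Arr.val_new]
  omega

theorem represents_buckets (h : Represents L φ) (i : Fin n) :
    Represents ((buckets L).val i) (delta φ i) := by
  have hdelta : delta φ i = {c ∈ φ | i ∈ c ∧ ∀ j ∈ c, j ≤ i} := by
    ext c
    simp [mem_delta]
  rw [buckets_val, hdelta]
  refine (h.filter fun c _ => ?_).reverse
  simp [List.max?_eq_some_iff]

theorem sum_cells_buckets_le (L : List (List (Fin n))) :
    ∑ i, cells ((buckets L).val i) ≤ cells L := by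
  simp only [buckets_val, cells, List.map_reverse, List.sum_reverse]
  induction L with
  | nil => simp
  | cons c L ih =>
    have hcons : ∀ i, (((c :: L).filter fun c => c.max? = some i).map fun c => 1 + c.length).sum =
        (if c.max? = some i then 1 + c.length else 0) +
          ((L.filter fun c => c.max? = some i).map fun c => 1 + c.length).sum := fun i => by
      by_cases h : c.max? = some i <;> simp [h]
    simp only [hcons, Finset.sum_add_distrib, List.map_cons, List.sum_cons]
    refine Nat.add_le_add ?_ ih
    rcases c.max? with _ | j <;> simp

end Buckets

/-! ### Computing smallest completions -/

section Complete

variable {φ : Finset (Finset (Fin n))} {B : Arr n (List (List (Fin n)))}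

theorem hits_val (A : Arr n Bool) (c : List (Fin n)) : (hits A c).val = c.any A := by
  rw [hits, loop_val]
  exact (foldl_or A false c).trans (Bool.false_or _)

theorem hits_time_le (A : Arr n Bool) (c : List (Fin n)) : (hits A c).time ≤ 1 + 2 * c.length := by
  refine (loop_time_le_length_mul 1 (by simp)).trans ?_
  omega

/-- Does some clause in the list contain no variable of the term `A`? -/
def anyMissed (A : Arr n Bool) (l : List (List (Fin n))) : Timed Bool :=
  loop (fun b c => do
    let h ← hits A c
    return b || !h) false l

/-- The treatment of one variable in `complete`. -/
def completeStep (B : Arr n (List (List (Fin n)))) (k : ℕ) (A : Arr n Bool) (j : Fin n) :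
    Timed (Arr n Bool) := do
  if k ≤ j.val then
    let l ← B.get j
    let needed ← anyMissed A l
    if needed then A.set j true else return A
  else return A

theorem complete_eq (B : Arr n (List (List (Fin n)))) (k : ℕ) (A : Arr n Bool) :
    complete B k A = loop (completeStep B k) A (List.finRange n) := rfl

theorem anyMissed_val (A : Arr n Bool) (l : List (List (Fin n))) :
    (anyMissed A l).val = true ↔ ∃ c ∈ l, Disjoint c.toFinset (support A) := by
  have hval : (anyMissed A l).val = l.any fun c => !c.any A := by
    simp only [anyMissed, loop_val, Timed.val_bind, Timed.val_pure, hits_val, foldl_or,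
      Bool.false_or]
  rw [hval, List.any_eq_true]
  exact exists_congr fun c => and_congr_right fun _ => not_any_iff_disjoint

theorem anyMissed_time_le (A : Arr n Bool) (l : List (List (Fin n))) :
    (anyMissed A l).time ≤ 1 + 2 * cells l := by
  refine loop_time_le_mul_cells 2 fun b c _ => ?_
  have := hits_time_le A c
  simp only [Timed.time_bind, Timed.time_pure]
  omega

theorem support_completeStep (hB : ∀ i, Represents (B i) (delta φ i)) (k : ℕ) (A : Arr n Bool)
    (j : Fin n) : support (completeStep B k A j).val =
      if k ≤ j.val then extend φ j (support A) else support A := by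
  have hmissed : (anyMissed A (B j)).val = true ↔ ∃ c ∈ delta φ j, Disjoint c (support A) := by
    simp [anyMissed_val, (hB j).mem_iff]
  by_cases hk : k ≤ j.val
  · simp only [completeStep, hk, if_true, Timed.val_bind, Arr.val_get, extend, ← hmissed]
    split_ifs
    · exact support_update_true A j
    · rfl
  · simp [completeStep, hk]

theorem support_complete (hB : ∀ i, Represents (B i) (delta φ i)) (k : ℕ) (A : Arr n Bool) :
    support (complete B k A).val = completion φ k (support A) := by
  rw [complete_eq, loop_val]
  exact (List.foldl_hom support fun A j => (support_completeStep hB k A j).symm).symm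

theorem complete_time_le (B : Arr n (List (List (Fin n)))) (k : ℕ) (A : Arr n Bool) :
    (complete B k A).time ≤ 1 + 4 * n + 2 * ∑ i, cells (B i) := by
  have hloop := loop_finRange_time_le (g := completeStep B k) (b := A) 3
    (fun i => 2 * cells (B i)) fun A j => by
      have := anyMissed_time_le A (B j)
      rw [completeStep]
      split_ifs
      · simp only [Timed.time_bind, Arr.time_get, Arr.val_get]
        split_ifs <;> simp only [Arr.time_set, Timed.time_pure] <;> omega
      · simp
  rw [complete_eq, Finset.mul_sum]
  omega

end Complete

/-! ### Residual CNFs -/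

section BuildResidual

variable {φ : Finset (Finset (Fin n))} {B : Arr n (List (List (Fin n)))}

/-- Remove `x_i` from the clause `c` and check whether another variable of it belongs to the term
`A`. -/
def splitClause (A : Arr n Bool) (i : Fin n) (c : List (Fin n)) : Timed (Bool × List (Fin n)) :=
  loop (fun (p : Bool × List (Fin n)) j => do
    if j = i then return p
    else
      let b ← A.get j
      return (p.1 || b, j :: p.2)) (false, []) c

theorem buildResidual_eq (B : Arr n (List (List (Fin n)))) (A : Arr n Bool) (i : Fin n) :
    buildResidual B A i = (do
      let l ← B.get i
      loop (fun Γ c => do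
        let (h, c') ← splitClause A i c
        if h then return Γ else return (c' :: Γ)) [] l) := rfl

theorem splitClause_val (A : Arr n Bool) (i : Fin n) (c : List (Fin n)) :
    (splitClause A i c).val = ((c.filter (· ≠ i)).any A, (c.filter (· ≠ i)).reverse) := by
  suffices h : ∀ p : Bool × List (Fin n),
      c.foldl (fun p j => if j = i then p else (p.1 || A j, j :: p.2)) p =
        (p.1 || (c.filter (· ≠ i)).any A, (c.filter (· ≠ i)).reverse ++ p.2) by
    simpa [splitClause, loop_val, apply_ite Timed.val] using h (false, [])
  induction c with
  | nil => simp
  | cons j c ih =>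
    intro p
    by_cases hj : j = i <;> simp [hj, ih, Bool.or_assoc]

theorem splitClause_time_le (A : Arr n Bool) (i : Fin n) (c : List (Fin n)) :
    (splitClause A i c).time ≤ 1 + 2 * c.length := by
  refine (loop_time_le_length_mul 1 fun p j _ => ?_).trans ?_
  · split_ifs <;> simp
  · omega

theorem buildResidual_val (B : Arr n (List (List (Fin n)))) (A : Arr n Bool) (i : Fin n) :
    (buildResidual B A i).val = (((B i).filter fun c => !(c.filter (· ≠ i)).any A).map
      fun c => (c.filter (· ≠ i)).reverse).reverse := by
  have hstep : ∀ (Γ : List (List (Fin n))) (b : Bool) (c : List (Fin n)),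
      (if b = true then (pure Γ : Timed _) else pure (c :: Γ)).val =
        if (!b) = true then c :: Γ else Γ := by
    rintro Γ (_ | _) c <;> rfl
  simp only [buildResidual_eq, Timed.val_bind, Arr.val_get, loop_val, splitClause_val, hstep]
  exact (foldl_ite_cons (fun c : List (Fin n) => !(c.filter (· ≠ i)).any A) _ _ _).trans
    (List.append_nil _)

theorem represents_buildResidual (hB : ∀ i, Represents (B i) (delta φ i)) (A : Arr n Bool)
    (i : Fin n) : Represents (buildResidual B A i).val (residual φ i (support A)) := by
  have htoFinset : ∀ c : List (Fin n), (c.filter (· ≠ i)).toFinset = c.toFinset.erase i :=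
    fun c => by ext; simp [and_comm]
  rw [buildResidual_val, residual_eq_image]
  refine (((hB i).filter fun c hc => ?_).map (fun c hc => ?_) (fun c _ => ?_) ?_).reverse
  · have hle := (mem_delta.1 ((hB i).mem hc)).2.2
    rw [not_any_iff_disjoint, htoFinset, Finset.disjoint_left, Finset.disjoint_left]
    simp only [Finset.mem_erase, mem_truncate, Fin.val_fin_lt]
    grind
  · exact List.nodup_reverse.2 (((hB i).2.1 c (List.mem_of_mem_filter hc)).filter _)
  · rw [List.toFinset_reverse, htoFinset]
  · exact (Finset.erase_injOn' i).mono fun d hd => (mem_delta.1 (Finset.mem_filter.1 hd).1).2.1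

theorem buildResidual_time_le (B : Arr n (List (List (Fin n)))) (A : Arr n Bool) (i : Fin n) :
    (buildResidual B A i).time ≤ 2 + 2 * cells (B i) := by
  rw [buildResidual_eq, Timed.time_bind, Arr.time_get, Arr.val_get, show 2 = 1 + 1 from rfl,
    Nat.add_assoc]
  refine Nat.add_le_add_left (loop_time_le_mul_cells 2 fun Γ c _ => ?_) 1
  have := splitClause_time_le A i c
  simp only [Timed.time_bind]
  split_ifs <;> simp only [Timed.time_pure] <;> omega

end BuildResidual

/-! ### Conjunctions of terms -/

theorem support_const_false : support (fun _ : Fin n => false) = ∅ := by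
  simp [support]

theorem support_update_of_eq_truncate {A S : Arr n Bool} {k : Fin n}
    (hS : support S = truncate k (support A)) :
    support (Function.update S k (A k)) = truncate (k + 1) (support A) := by
  by_cases hk : A k = true
  · rw [hk, support_update_true, hS, truncate_succ_of_mem (mem_support.2 hk)]
  · have hSk : S k ≠ true := fun h => (mem_truncate.1 (hS ▸ mem_support.2 h)).2.false
    rw [truncate_succ_of_notMem (mt mem_support.1 hk), ← hS, Bool.eq_false_iff.2 hk,
      ← Bool.eq_false_iff.2 hSk, Function.update_eq_self]

theorem support_foldl_update_true (S : Arr n Bool) (r : List (Fin n)) :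
    support (r.foldl (fun S j => Function.update S j true) S) = support S ∪ r.toFinset := by
  induction r generalizing S with
  | nil => simp
  | cons j r ih => simp [ih, support_update_true]

theorem support_merge (A : Arr n Bool) (i : Fin n) (r : List (Fin n)) :
    support (merge A i r).val = truncate i (support A) ∪ r.toFinset := by
  have hcopy := foldl_finRange_induction
    (g := fun (S : Arr n Bool) j =>
      (if j < i then A.get j >>= fun b => S.set j b else pure S : Timed _).val)
    (b := fun _ => false) (fun m S => support S = truncate (min m i) (support A))
    (by simp [support_const_false, truncate_zero]) fun k S hS => by
      split_ifs with hk
      · have hk : k.val < i := hk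
        rw [min_eq_left hk.le] at hS
        rw [min_eq_left hk]
        exact support_update_of_eq_truncate hS
      · have hk : i.val ≤ k := not_lt.1 hk
        rw [min_eq_right hk] at hS
        rw [min_eq_right (hk.trans k.val.le_succ)]
        exact hS
  rw [min_eq_right i.isLt.le] at hcopy
  rw [merge, Timed.val_bind, Arr.val_new, Timed.val_bind, loop_val, loop_val, ← hcopy]
  exact support_foldl_update_true _ r

theorem merge_time_le (A : Arr n Bool) (i : Fin n) (r : List (Fin n)) :
    (merge A i r).time ≤ 3 + 4 * n + 2 * r.length := by
  have hcopy : ∀ S : Arr n Bool, (loop (fun (S : Arr n Bool) j => do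
      if j < i then
        let b ← A.get j
        S.set j b
      else return S) S (List.finRange n)).time ≤ 1 + n * 3 := fun S => by
    simpa using loop_time_le_length_mul (b := S) (l := List.finRange n) 2 fun S j _ => by
      split_ifs <;> simp
  have hset : ∀ S : Arr n Bool,
      (loop (fun (S : Arr n Bool) j => S.set j true) S r).time ≤ 1 + r.length * 2 := fun S =>
    loop_time_le_length_mul 1 fun S j _ => le_rfl
  rw [merge, Timed.time_bind, Timed.time_bind, Arr.time_new]
  refine (Nat.add_le_add_left (Nat.add_le_add (hcopy _) (hset _)) _).trans ?_
  omega

/-! ### The primality test -/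

section IsPrime

variable {φ : Finset (Finset (Fin n))} {B : Arr n (List (List (Fin n)))} {S : Arr n Bool}

theorem mem_fixed_succ_iff {c : Finset (Fin n)} {i : Fin n} (hφ : ∅ ∉ φ) :
    c ∈ fixed φ (i + 1) ↔ ∃ k ≤ i, c ∈ delta φ k := by
  simp only [mem_fixed, mem_delta, Nat.lt_succ_iff, Fin.val_fin_le]
  constructor
  · rintro ⟨hc, hle⟩
    have hne : c.Nonempty := Finset.nonempty_iff_ne_empty.2 fun h => hφ (h ▸ hc)
    exact ⟨c.max' hne, hle _ (c.max'_mem hne), hc, c.max'_mem hne, c.le_max'⟩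
  · rintro ⟨k, hki, hc, -, hle⟩
    exact ⟨hc, fun j hj => (hle j hj).trans hki⟩

/-- The variables of the clause `c` that belong to the term `S`. -/
def commonVars (S : Arr n Bool) (c : List (Fin n)) : Timed (List (Fin n)) :=
  loop (fun (h : List (Fin n)) j => do
    if ← S.get j then return j :: h else return h) [] c

/-- The treatment of one clause in `isPrime`. -/
def markClause (S : Arr n Bool) (s : Bool × Arr n Bool) (c : List (Fin n)) :
    Timed (Bool × Arr n Bool) := do
  let found ← commonVars S c
  match found with
  | [] => return (false, s.2)
  | [j] =>
      let P' ← s.2.set j true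
      return (s.1, P')
  | _ => return s

/-- The treatment of the clauses with last variable `x_k` in `isPrime`. -/
def markBucket (B : Arr n (List (List (Fin n)))) (S : Arr n Bool) (i : Fin n)
    (s : Bool × Arr n Bool) (k : Fin n) : Timed (Bool × Arr n Bool) := do
  if k ≤ i then
    let l ← B.get k
    loop (markClause S) s l
  else return s

/-- Are all variables of the term `S` marked in `P`, and does `ok` hold? -/
def allMarked (S P : Arr n Bool) (ok : Bool) : Timed Bool :=
  loop (fun ok j => do
    let b ← S.get j
    let p ← P.get j
    return ok && (!b || p)) ok (List.finRange n)

theorem isPrime_eq (B : Arr n (List (List (Fin n)))) (S : Arr n Bool) (i : Fin n) :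
    isPrime B S i = (do
      let P ← Arr.new n false
      let s ← loop (markBucket B S i) (true, P) (List.finRange n)
      allMarked S s.2 s.1) := rfl

/-- Passing from the state `s` to the state `s'` of the loops of `isPrime` amounts to testing `p`
and marking the variables in `M`. -/
structure Marks (p : Prop) (M : Fin n → Prop) (s s' : Bool × Arr n Bool) : Prop where
  fst_iff : s'.1 = true ↔ s.1 = true ∧ p
  snd_iff : ∀ j, s'.2 j = true ↔ s.2 j = true ∨ M j

theorem marks_loop {α : Type} {g : Bool × Arr n Bool → α → Timed (Bool × Arr n Bool)}
    {p : α → Prop} {M : α → Fin n → Prop} (l : List α)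
    (hg : ∀ s, ∀ a ∈ l, Marks (p a) (M a) s (g s a).val) (s : Bool × Arr n Bool) :
    Marks (∀ a ∈ l, p a) (fun j => ∃ a ∈ l, M a j) s (loop g s l).val := by
  induction l generalizing s with
  | nil => constructor <;> simp [loop]
  | cons a l ih =>
    have hhead := hg s a List.mem_cons_self
    have htail := ih (fun s a ha => hg s a (List.mem_cons_of_mem _ ha)) (g s a).val
    constructor
    · simp [loop, htail.fst_iff, hhead.fst_iff, and_assoc]
    · simp [loop, htail.snd_iff, hhead.snd_iff, or_assoc]

theorem commonVars_val (S : Arr n Bool) (c : List (Fin n)) :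
    (commonVars S c).val = (c.filter S).reverse := by
  calc (commonVars S c).val = c.foldl (fun h j => if S j = true then j :: h else h) [] := by
        rw [commonVars, loop_val]
        congr 1
        funext h j
        by_cases hj : S j = true <;> simp [hj]
    _ = (c.filter S).reverse := by simpa using foldl_ite_cons S id c []

theorem commonVars_time_le (S : Arr n Bool) (c : List (Fin n)) :
    (commonVars S c).time ≤ 1 + 2 * c.length := by
  refine (loop_time_le_length_mul 1 fun h j _ => ?_).trans ?_
  · by_cases hj : S j = true <;> simp [hj]
  · omega

theorem marks_markClause {c : List (Fin n)} (hc : c.Nodup) (s : Bool × Arr n Bool) :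
    Marks (c.toFinset ∩ support S).Nonempty (fun j => c.toFinset ∩ support S = {j}) s
      (markClause S s c).val := by
  have hinter : c.toFinset ∩ support S = (commonVars S c).val.toFinset := by
    ext j
    simp [commonVars_val, mem_support]
  have hnodup : (commonVars S c).val.Nodup := by
    rw [commonVars_val]
    exact List.nodup_reverse.2 (hc.filter _)
  rw [hinter, markClause, Timed.val_bind]
  generalize (commonVars S c).val = found at hnodup ⊢
  rcases found with _ | ⟨a, _ | ⟨b, l⟩⟩
  · exact ⟨by simp, fun j => by simp [(Finset.singleton_ne_empty j).symm]⟩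
  · refine ⟨by simp, fun j => ?_⟩
    by_cases hj : j = a <;> simp [hj, Ne.symm]
  · refine ⟨by simp, fun j => ?_⟩
    have hcard : (a :: b :: l).toFinset ≠ {j} := fun h => by
      have := congrArg Finset.card h
      simp [-List.toFinset_cons, List.toFinset_card_of_nodup hnodup] at this
    simp only [hcard, or_false]
    rfl

theorem markClause_time_le (S : Arr n Bool) (s : Bool × Arr n Bool) (c : List (Fin n)) :
    (markClause S s c).time ≤ 2 + 2 * c.length := by
  have := commonVars_time_le S c
  rw [markClause, Timed.time_bind]
  split <;> simp <;> omega

theorem marks_markBucket (hB : ∀ i, Represents (B i) (delta φ i)) (S : Arr n Bool) (i k : Fin n)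
    (s : Bool × Arr n Bool) :
    Marks (k ≤ i → IsTransversal (delta φ k) (support S))
      (fun j => k ≤ i ∧ ∃ c ∈ delta φ k, c ∩ support S = {j}) s (markBucket B S i s k).val := by
  by_cases hk : k ≤ i
  · have hloop := marks_loop (B k) (fun s c hc => marks_markClause (S := S) ((hB k).2.1 c hc) s) s
    simpa [IsTransversal, (hB k).mem_iff, markBucket, hk] using hloop
  · constructor <;> simp [markBucket, hk]

theorem foldl_and {α : Type*} (f : α → Bool) (b : Bool) (l : List α) :
    l.foldl (fun b a => b && f a) b = (b && l.all f) := by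
  induction l generalizing b with
  | nil => simp
  | cons a l ih => simp [ih, Bool.and_assoc]

theorem allMarked_val (S P : Arr n Bool) (ok : Bool) :
    (allMarked S P ok).val = true ↔ ok = true ∧ ∀ j ∈ support S, P j = true := by
  have hval : (allMarked S P ok).val = (ok && (List.finRange n).all fun j => !S j || P j) := by
    simp only [allMarked, loop_val, Timed.val_bind, Timed.val_pure, Arr.val_get, foldl_and]
  simp [hval, mem_support, or_iff_not_imp_left]

theorem isPrime_val (hφ : ∅ ∉ φ) (hB : ∀ i, Represents (B i) (delta φ i)) (S : Arr n Bool)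
    (i : Fin n) : (isPrime B S i).val = true ↔
      Minimal (IsTransversal (fixed φ (i + 1))) (support S) := by
  have hmarks := marks_loop (List.finRange n)
    (fun s k _ => marks_markBucket hB S i k s) (true, fun _ => false)
  rw [isPrime_eq, Timed.val_bind, Timed.val_bind, allMarked_val, Arr.val_new, hmarks.fst_iff]
  simp only [hmarks.snd_iff, minimal_isTransversal_iff, IsTransversal, mem_fixed_succ_iff hφ]
  grind

theorem isPrime_time_le (B : Arr n (List (List (Fin n)))) (S : Arr n Bool) (i : Fin n) :
    (isPrime B S i).time ≤ 3 + 7 * n + 3 * ∑ i, cells (B i) := by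
  have hbucket : ∀ s k, (markBucket B S i s k).time ≤ 2 + 3 * cells (B k) := fun s k => by
    have hloop := loop_time_le_mul_cells (L := B k) (b := s) (g := markClause S) 3 fun s c _ => by
      have := markClause_time_le S s c
      omega
    rw [markBucket]
    split_ifs
    · simp only [Timed.time_bind, Arr.time_get, Arr.val_get]
      omega
    · simp
  have hloop := loop_finRange_time_le (b := (true, fun _ => false)) 2 (fun k => 3 * cells (B k))
    hbucket
  have hall : ∀ P ok, (allMarked S P ok).time ≤ 1 + n * 3 := fun P ok => by
    simpa [allMarked] using loop_time_le_length_mul (b := ok) (l := List.finRange n) 2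
      (g := fun ok j => do
        let b ← S.get j
        let p ← P.get j
        return ok && (!b || p)) fun ok j _ => by simp
  rw [isPrime_eq, Timed.time_bind, Timed.time_bind, Arr.time_new, Arr.val_new, Finset.mul_sum]
  refine (Nat.add_le_add_left (Nat.add_le_add hloop (hall _ _)) _).trans ?_
  omega

end IsPrime

/-! ### One pass of the main loop -/

section Pass

variable {φ : Finset (Finset (Fin n))} {B : Arr n (List (List (Fin n)))}
  {D : List (List (Fin n)) → Timed (List (List (Fin n)))} {A : Arr n Bool} {i : Fin n}

/-- The subroutine `D` computes the prime DNFs of the formulas `Δ^i[t]` with `x_i ∈ V(t)`, in at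
most `τ i` steps each. -/
def DualizesResiduals (D : List (List (Fin n)) → Timed (List (List (Fin n))))
    (φ : Finset (Finset (Fin n))) (t : Finset (Fin n)) (τ : Fin n → ℕ) : Prop :=
  ∀ i ∈ t, (residual φ i t).Nonempty → ∀ Γ, Represents Γ (residual φ i t) →
    Represents (D Γ).val (rho φ t i) ∧ (D Γ).time ≤ τ i

/-- Passing from the queue `Q` to the queue `Q'` amounts to inserting the terms in `U`. -/
structure Adds (U : Set (Finset (Fin n))) (Q Q' : Tree) : Prop where
  wf (hQ : Tree.WF (List.finRange n) Q) : Tree.WF (List.finRange n) Q'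
  terms_eq (hQ : Tree.WF (List.finRange n) Q) :
    Tree.terms (List.finRange n) Q' = Tree.terms (List.finRange n) Q ∪ U

theorem adds_empty (Q : Tree) : Adds (∅ : Set (Finset (Fin n))) Q Q :=
  ⟨id, fun _ => (Set.union_empty _).symm⟩

theorem adds_insert (A : Arr n Bool) (Q : Tree) :
    Adds {support A} Q (Tree.insert A (List.finRange n) Q).val :=
  ⟨Tree.wf_insert A, fun hQ => by simp [Tree.terms_insert A hQ]⟩

theorem adds_loop {α : Type} {g : Tree → α → Timed Tree} {U : α → Set (Finset (Fin n))}
    (l : List α) (hg : ∀ Q, ∀ a ∈ l, Adds (U a) Q (g Q a).val) (Q : Tree) :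
    Adds (⋃ a ∈ l, U a) Q (loop g Q l).val := by
  induction l generalizing Q with
  | nil => simpa [loop] using adds_empty Q
  | cons a l ih =>
    have hhead := hg Q a List.mem_cons_self
    have htail := ih (fun Q a ha => hg Q a (List.mem_cons_of_mem _ ha)) (g Q a).val
    refine ⟨fun hQ => htail.wf (hhead.wf hQ), fun hQ => ?_⟩
    simp [loop, htail.terms_eq (hhead.wf hQ), hhead.terms_eq hQ, Set.union_assoc,
      Set.iUnion_or, Set.iUnion_union_distrib]

/-- The treatment of the term `r` of `ρ_{(t,i)}` in `process`. -/
def enqueue (B : Arr n (List (List (Fin n)))) (A : Arr n Bool) (i : Fin n) (Q : Tree)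
    (r : List (Fin n)) : Timed Tree := do
  let S ← merge A i r
  if ← isPrime B S i then
    let A' ← complete B (i.val + 1) S
    Tree.insert A' (List.finRange n) Q
  else return Q

/-- The treatment of the variable `x_i` in `process`. -/
def processVar (B : Arr n (List (List (Fin n))))
    (D : List (List (Fin n)) → Timed (List (List (Fin n)))) (A : Arr n Bool) (Q : Tree)
    (i : Fin n) : Timed Tree := do
  if ← A.get i then
    match ← buildResidual B A i with
    | [] => return Q
    | c :: Γ =>
        let ρ ← D (c :: Γ)
        loop (enqueue B A i) Q ρ
  else return Q

theorem process_eq (B : Arr n (List (List (Fin n))))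
    (D : List (List (Fin n)) → Timed (List (List (Fin n)))) (A : Arr n Bool) (Q : Tree) :
    process B D A Q = loop (processVar B D A) Q (List.finRange n) := rfl

theorem adds_enqueue (hφ : ∅ ∉ φ) (hB : ∀ i, Represents (B i) (delta φ i)) (A : Arr n Bool)
    (i : Fin n) (Q : Tree) (r : List (Fin n)) :
    Adds {u | Minimal (IsTransversal (fixed φ (i + 1))) (truncate i (support A) ∪ r.toFinset) ∧
      completion φ (i + 1) (truncate i (support A) ∪ r.toFinset) = u} Q
      (enqueue B A i Q r).val := by
  rw [enqueue, Timed.val_bind, Timed.val_bind, ← support_merge, ← isPrime_val hφ hB]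
  split_ifs with hprime
  · simpa [hprime, ← support_complete hB, eq_comm] using adds_insert _ Q
  · simpa [hprime] using adds_empty Q

theorem adds_processVar (hφ : ∅ ∉ φ) (hB : ∀ i, Represents (B i) (delta φ i)) {τ : Fin n → ℕ}
    (hD : DualizesResiduals D φ (support A) τ) (Q : Tree) (i : Fin n) :
    Adds {u | i ∈ support A ∧ GeneratesVia φ (support A) i u} Q (processVar B D A Q i).val := by
  rw [processVar, Timed.val_bind, Arr.val_get]
  by_cases hi : A i = true
  swap
  · simpa [hi, mem_support] using adds_empty Q
  have hΓ := represents_buildResidual hB A i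
  rw [if_pos hi, Timed.val_bind]
  cases h : (buildResidual B A i).val with
  | nil =>
    have hempty : residual φ i (support A) = ∅ := by simp [← hΓ.2.2, h]
    simpa [GeneratesVia, hempty] using adds_empty Q
  | cons c Γ =>
    rw [h] at hΓ
    have hne : (residual φ i (support A)).Nonempty := ⟨_, hΓ.mem List.mem_cons_self⟩
    have hρ := (hD i (mem_support.2 hi) hne _ hΓ).1
    refine (congrArg (Adds · Q _) ?_).mp
      (adds_loop (D (c :: Γ)).val (fun Q r _ => adds_enqueue hφ hB A i Q r) Q)
    ext u
    simp only [GeneratesVia, hne, mem_support.2 hi, hρ.mem_iff, Set.mem_iUnion, Set.mem_ofPred_eq,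
      exists_prop, true_and, exists_exists_and_eq_and]

theorem adds_process (hφ : ∅ ∉ φ) (hB : ∀ i, Represents (B i) (delta φ i)) {τ : Fin n → ℕ}
    (hD : DualizesResiduals D φ (support A) τ) (Q : Tree) :
    Adds {u | Generates φ (support A) u} Q (process B D A Q).val := by
  rw [process_eq]
  refine (congrArg (Adds · Q _) ?_).mp
    (adds_loop (List.finRange n) (fun Q i _ => adds_processVar hφ hB hD Q i) Q)
  ext u
  simp [Generates]

variable {N : ℕ}

theorem enqueue_time_le (hn : n ≤ N) (hN : 1 ≤ N) (hcells : ∑ i, cells (B i) ≤ 2 * N)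
    (A : Arr n Bool) (i : Fin n) (Q : Tree) {r : List (Fin n)} (hr : r.Nodup) :
    (enqueue B A i Q r).time ≤ 37 * N := by
  have hmerge := merge_time_le A i r
  have hprime := isPrime_time_le B (merge A i r).val i
  have hcomplete := complete_time_le B (i.val + 1) (merge A i r).val
  have hinsert := Tree.insert_time_le (complete B (i.val + 1) (merge A i r).val).val
    (List.finRange n) Q
  have hlength : r.length ≤ n := by simpa using hr.length_le_card
  rw [List.length_finRange] at hinsert
  rw [enqueue, Timed.time_bind, Timed.time_bind]
  split_ifs
  · rw [Timed.time_bind]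
    omega
  · rw [Timed.time_pure]
    omega

theorem processVar_time_le (hB : ∀ i, Represents (B i) (delta φ i)) {τ : Fin n → ℕ}
    (hD : DualizesResiduals D φ (support A) τ) (hn : n ≤ N) (hN : 1 ≤ N)
    (hcells : ∑ i, cells (B i) ≤ 2 * N) (Q : Tree) (i : Fin n) :
    (processVar B D A Q i).time ≤ 4 + (2 * cells (B i) +
      if i ∈ support A then τ i + (rho φ (support A) i).card * (38 * N) else 0) := by
  rw [processVar, Timed.time_bind, Arr.val_get, Arr.time_get]
  by_cases hi : A i = true
  swap
  · simp [hi, mem_support]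
    omega
  have hΓ := represents_buildResidual hB A i
  have htime := buildResidual_time_le B A i
  rw [if_pos hi, if_pos (mem_support.2 hi), Timed.time_bind]
  cases h : (buildResidual B A i).val with
  | nil =>
    rw [Timed.time_pure]
    omega
  | cons c Γ =>
    rw [h] at hΓ
    have hne : (residual φ i (support A)).Nonempty := ⟨_, hΓ.mem List.mem_cons_self⟩
    obtain ⟨hρ, hτ⟩ := hD i (mem_support.2 hi) hne _ hΓ
    have hloop := loop_time_le_length_mul (g := enqueue B A i) (b := Q) (37 * N) fun Q r hr =>
      enqueue_time_le hn hN hcells A i Q (hρ.2.1 r hr)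
    rw [hρ.length_eq_card] at hloop
    have hcard : (rho φ (support A) i).card * (1 + 37 * N) ≤
        (rho φ (support A) i).card * (38 * N) := Nat.mul_le_mul_left _ (by omega)
    simp only [Timed.time_bind]
    omega

theorem process_time_le (hB : ∀ i, Represents (B i) (delta φ i)) {T : Finset (Fin n) → Fin n → ℕ}
    (hD : DualizesResiduals D φ (support A) (T (support A))) (hn : n ≤ length φ)
    (hφ : 1 ≤ length φ) (hcells : ∑ i, cells (B i) ≤ 2 * length φ) (Q : Tree) :
    (process B D A Q).time ≤ passBound φ T 38 (support A) + 10 * length φ := by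
  have hloop := loop_finRange_time_le (b := Q) 4 _ (processVar_time_le hB hD hn hφ hcells)
  rw [Finset.sum_add_distrib, ← Finset.mul_sum, ← Finset.sum_filter, Finset.filter_mem_eq_inter,
    Finset.univ_inter] at hloop
  rw [process_eq, passBound]
  omega

theorem emit_time_le (Q : Tree) : (emit n Q).time ≤ 4 * n + 3 := by
  have hpop := Tree.popMin_time_le (List.finRange n) Q fun _ => false
  rw [List.length_finRange] at hpop
  simp only [emit, Timed.time_bind, Arr.time_new, Arr.val_new, time_charge, Timed.time_pure]
  omega

theorem isPopMin_emit {Q : Tree} (hQ : Tree.WF (List.finRange n) Q) (hne : Q ≠ .empty) :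
    Tree.IsPopMin (List.finRange n) Q (support (emit n Q).val.1) (emit n Q).val.2 := by
  obtain ⟨m, hsupp, hm⟩ := Tree.exists_isPopMin_popMin (List.pairwise_lt_finRange n) hQ hne
    fun _ => false
  rw [support_const_false, Finset.union_empty] at hsupp
  exact hsupp ▸ hm

end Pass

/-! ### The main loop -/

section Loop

variable {φ : Finset (Finset (Fin n))} {R : Finset (Finset (Fin n))} {m t : Finset (Fin n)}
  {Q Q' Q'' : Tree} {B : Arr n (List (List (Fin n)))}
  {D : List (List (Fin n)) → Timed (List (List (Fin n)))}

/-- The invariant of the main loop, where `R` is the set of the prime implicants still to be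
printed: each of them is in the queue or will be generated by another one. -/
structure QueueInvariant (φ : Finset (Finset (Fin n))) (R : Finset (Finset (Fin n))) (Q : Tree) :
    Prop where
  wf : Tree.WF (List.finRange n) Q
  minimal : ∀ t ∈ R, Minimal (IsTransversal φ) t
  mem_of_weight_lt : ∀ s ∈ R, ∀ t, Minimal (IsTransversal φ) t → weight s < weight t → t ∈ R
  mem_of_mem_terms : ∀ t ∈ Tree.terms (List.finRange n) Q, t ∈ R
  mem_terms_or : ∀ t ∈ R, t ∈ Tree.terms (List.finRange n) Q ∨ ∃ s ∈ R, Generates φ s t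

namespace QueueInvariant

theorem exists_mem_terms_weight_le (h : QueueInvariant φ R Q) (ht : t ∈ R) :
    ∃ s ∈ Tree.terms (List.finRange n) Q, weight s ≤ weight t := by
  obtain ⟨s, hs, hmin⟩ := R.exists_min_image weight ⟨t, ht⟩
  refine ⟨s, (h.mem_terms_or s hs).resolve_right ?_, hmin t ht⟩
  rintro ⟨u, hu, hus⟩
  exact (hmin u hu).not_gt hus.weight_lt

theorem eq_empty (h : QueueInvariant φ R .empty) : R = ∅ :=
  Finset.eq_empty_of_forall_notMem fun t ht => by
    simpa using h.exists_mem_terms_weight_le ht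

theorem weight_lt (h : QueueInvariant φ R Q) (hm : Tree.IsPopMin (List.finRange n) Q m Q')
    (ht : t ∈ R) (htm : t ≠ m) : weight m < weight t := by
  obtain ⟨s, hs, hst⟩ := h.exists_mem_terms_weight_le ht
  exact ((hm.weight_le s hs).trans hst).lt_of_ne fun hmt => htm (weight_injective hmt).symm

theorem erase (h : QueueInvariant φ R Q) (hm : Tree.IsPopMin (List.finRange n) Q m Q')
    (hQ : Adds {u | Generates φ m u} Q' Q'') : QueueInvariant φ (R.erase m) Q'' := by
  have hmR : m ∈ R := h.mem_of_mem_terms m hm.mem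
  have hterms : ∀ t, t ∈ Tree.terms (List.finRange n) Q'' ↔
      t ∈ Tree.terms (List.finRange n) Q ∧ t ≠ m ∨ Generates φ m t := fun t => by
    rw [hQ.terms_eq hm.wf, hm.terms_eq]
    rfl
  refine ⟨hQ.wf hm.wf, fun t ht => h.minimal t (Finset.mem_of_mem_erase ht),
    fun s hs t ht hst => ?_, fun t ht => ?_, fun t ht => ?_⟩
  · obtain ⟨hsm, hsR⟩ := Finset.mem_erase.1 hs
    refine Finset.mem_erase.2 ⟨?_, h.mem_of_weight_lt s hsR t ht hst⟩
    rintro rfl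
    exact (h.weight_lt hm hsR hsm).not_gt hst
  · rcases (hterms t).1 ht with ⟨ht, htm⟩ | hmt
    · exact Finset.mem_erase.2 ⟨htm, h.mem_of_mem_terms t ht⟩
    · refine Finset.mem_erase.2 ⟨?_, h.mem_of_weight_lt m hmR t hmt.minimal hmt.weight_lt⟩
      rintro rfl
      exact hmt.weight_lt.false
  · obtain ⟨htm, ht⟩ := Finset.mem_erase.1 ht
    rcases h.mem_terms_or t ht with htQ | ⟨s, hs, hst⟩
    · exact Or.inl ((hterms t).2 (Or.inl ⟨htQ, htm⟩))
    · rcases eq_or_ne s m with rfl | hsm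
      · exact Or.inl ((hterms t).2 (Or.inr hst))
      · exact Or.inr ⟨s, Finset.mem_erase.2 ⟨hsm, hs⟩, hst⟩

theorem exists_loop (hφ : ∅ ∉ φ) (hB : ∀ i, Represents (B i) (delta φ i))
    {T : Finset (Fin n) → Fin n → ℕ}
    (hD : ∀ t, Minimal (IsTransversal φ) t → DualizesResiduals D φ t (T t))
    (h : QueueInvariant φ R Q) (clock : ℕ) :
    ∃ (out : List (ℕ × Finset (Fin n))) (total : ℕ), Loop B D Q clock out total ∧
      (out.map Prod.snd).Pairwise (fun s t => weight s < weight t) ∧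
      ∀ t, t ∈ out.map Prod.snd ↔ t ∈ R := by
  induction R using Finset.strongInduction generalizing Q clock with
  | H R ih =>
    by_cases hne : Q = .empty
    · subst hne
      exact ⟨[], clock + 1, .halt clock, by simp, by simp [h.eq_empty]⟩
    have hm := isPopMin_emit h.wf hne
    set A := (emit n Q).val.1
    have hA : support A ∈ R := h.mem_of_mem_terms _ hm.mem
    have hstep := h.erase hm (adds_process hφ hB (hD _ (h.minimal _ hA)) _)
    obtain ⟨out, total, hloop, hsorted, hmem⟩ := ih _ (Finset.erase_ssubset hA) hstep
      (clock + (emit n Q).time + (process B D A (emit n Q).val.2).time)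
    refine ⟨_, total, .pass Q clock out total hne hloop, ?_, fun t => ?_⟩
    · refine List.pairwise_cons.2 ⟨fun t ht => ?_, hsorted⟩
      obtain ⟨htA, ht⟩ := Finset.mem_erase.1 ((hmem t).1 ht)
      exact h.weight_lt hm ht htA
    · rw [List.map_cons, List.mem_cons, hmem, ← Finset.mem_insert, Finset.insert_erase hA]

end QueueInvariant

namespace Loop

variable {clock total : ℕ} {out : List (ℕ × Finset (Fin n))} {e : ℕ} {p : Finset (Fin n) → ℕ}

theorem total_le (h : Loop B D Q clock out total) (he : ∀ Q, (emit n Q).time ≤ e)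
    (hp : ∀ A Q, support A ∈ out.map Prod.snd → (process B D A Q).time ≤ p (support A)) :
    total ≤ clock + 1 + ((out.map Prod.snd).map fun t => e + p t).sum := by
  induction h with
  | halt clock => simp
  | pass Q clock out total _ _ ih =>
    have hrest := ih fun A Q hA => hp A Q (List.mem_cons_of_mem _ hA)
    have hemit := he Q
    have hprocess := hp (emit n Q).val.1 (emit n Q).val.2 List.mem_cons_self
    simp only [List.map_cons, List.sum_cons]
    omega

theorem isChain (h : Loop B D Q clock out total) (he : ∀ Q, (emit n Q).time ≤ e)
    (hp : ∀ A Q, support A ∈ out.map Prod.snd → (process B D A Q).time ≤ p (support A)) {M : ℕ}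
    (hM : ∀ t ∈ out.map Prod.snd, p t + e + 1 ≤ M) {a : ℕ} (ha : clock + e + 1 ≤ a + M) :
    List.IsChain (fun a b => b ≤ a + M) ((a :: out.map Prod.fst) ++ [total]) := by
  induction h generalizing a with
  | halt clock => exact List.isChain_pair.2 (by omega)
  | pass Q clock out total _ _ ih =>
    have hemit := he Q
    have hprocess := hp (emit n Q).val.1 (emit n Q).val.2 List.mem_cons_self
    have hpass : p (support (emit n Q).val.1) + e + 1 ≤ M := hM _ List.mem_cons_self
    refine List.isChain_cons_cons.2 ⟨?_, ih (fun A Q hA => hp A Q (List.mem_cons_of_mem _ hA))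
      (fun t ht => hM t (List.mem_cons_of_mem _ ht)) ?_⟩
    · dsimp only
      omega
    · dsimp only
      omega

end Loop

theorem start_time_le (L : List (List (Fin n))) : (start L).time ≤ 8 * n + 5 + 6 * cells L := by
  have hbuckets := buckets_time_le L
  have hcells := sum_cells_buckets_le L
  have hcomplete := complete_time_le (buckets L).val 0 fun _ => false
  have hinsert := Tree.insert_time_le (complete (buckets L).val 0 fun _ => false).val
    (List.finRange n) .empty
  rw [List.length_finRange] at hinsert
  simp only [start, Timed.time_bind, Arr.time_new, Arr.val_new, Timed.time_pure]
  omega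

theorem queueInvariant_start (hφ : ∅ ∉ φ) {L : List (List (Fin n))} (hL : Represents L φ) :
    QueueInvariant φ (primeImplicants (cnfFun φ)) (start L).val.2 := by
  have hadds := adds_insert (complete (buckets L).val 0 fun _ => false).val .empty
  rw [support_complete (represents_buckets hL), support_const_false] at hadds
  have hterms : Tree.terms (List.finRange n) (start L).val.2 = {completion φ 0 ∅} :=
    (hadds.terms_eq (Tree.wf_empty _)).trans (by simp)
  have hmin : Minimal (IsTransversal (fixed φ 0)) ∅ := by
    refine minimal_isTransversal_iff.2 ⟨fun c hc => ?_, by simp⟩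
    obtain ⟨hcφ, hlt⟩ := mem_fixed.1 hc
    have hc : c = ∅ := Finset.eq_empty_of_forall_notMem fun j hj => (hlt j hj).not_ge j.val.zero_le
    exact absurd (hc ▸ hcφ) hφ
  refine ⟨hadds.wf (Tree.wf_empty _), fun t ht => mem_primeImplicants_cnfFun.1 ht,
    fun _ _ t ht _ => mem_primeImplicants_cnfFun.2 ht, fun t ht => ?_, fun t ht => ?_⟩
  · rw [hterms, Set.mem_singleton_iff] at ht
    exact mem_primeImplicants_cnfFun.2 (ht ▸ minimal_completion n.zero_le hmin)
  · rw [hterms, Set.mem_singleton_iff]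
    refine (eq_completion_or_exists_generates (mem_primeImplicants_cnfFun.1 ht)).imp Eq.symm ?_
    rintro ⟨s, hs, hst⟩
    exact ⟨s, mem_primeImplicants_cnfFun.2 hs, hst⟩

end Loop

/-! ### The bounds -/

section Bounds

variable {φ : Finset (Finset (Fin n))} {t : Finset (Fin n)}

theorem DelayAtMost.mono {M M' total : ℕ} {out : List (ℕ × Finset (Fin n))} (hM : M ≤ M')
    (h : DelayAtMost M out total) : DelayAtMost M' out total :=
  List.IsChain.imp (fun _ _ hab => hab.trans (Nat.add_le_add_left hM _)) h

theorem le_length (hocc : ∀ j : Fin n, ∃ c ∈ φ, j ∈ c) : n ≤ length φ :=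
  calc n = (Finset.univ : Finset (Fin n)).card := (Finset.card_fin n).symm
    _ ≤ (φ.biUnion id).card := Finset.card_le_card fun j _ => by simpa using hocc j
    _ ≤ length φ := Finset.card_biUnion_le

theorem exists_dualizeRun (hφ : ∅ ∉ φ) (hn : n ≤ length φ) (hpos : 1 ≤ length φ)
    {L : List (List (Fin n))} (hL : Represents L φ)
    {D : List (List (Fin n)) → Timed (List (List (Fin n)))} {T : Finset (Fin n) → Fin n → ℕ}
    (hD : ∀ t ∈ primeImplicants (cnfFun φ), DualizesResiduals D φ t (T t)) :
    ∃ (out : List (ℕ × Finset (Fin n))) (total : ℕ), DualizeRun L D out total ∧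
      (out.map Prod.snd).Pairwise (fun s t => weight s < weight t) ∧
      (∀ t, t ∈ out.map Prod.snd ↔ t ∈ primeImplicants (cnfFun φ)) ∧
      DelayAtMost ((primeImplicants (cnfFun φ)).sup fun t => passBound φ T 38 t + 43 * length φ)
        out total ∧
      total ≤ ∑ t ∈ primeImplicants (cnfFun φ), (passBound φ T 38 t + 43 * length φ) := by
  -- `43 = 25 + 7 + 10 + 1` for the start, the two parts of a pass and the final test of the queue.
  have hB := represents_buckets hL
  obtain ⟨out, total, hrun, hsorted, hmem⟩ := (queueInvariant_start hφ hL).exists_loop hφ hB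
    (fun t ht => hD t (mem_primeImplicants_cnfFun.2 ht)) (start L).time
  have hcells := hL.cells_le hφ
  have hstart : (start L).time ≤ 25 * length φ := (start_time_le L).trans (by omega)
  have hemit : ∀ Q, (emit n Q).time ≤ 7 * length φ := fun Q => (emit_time_le Q).trans (by omega)
  have hprocess : ∀ A Q, support A ∈ out.map Prod.snd →
      (process (buckets L).val D A Q).time ≤ passBound φ T 38 (support A) + 10 * length φ :=
    fun A Q hA => process_time_le hB (hD _ ((hmem _).1 hA)) hn hpos
      ((sum_cells_buckets_le L).trans hcells) Q
  obtain ⟨t₀, -, ht₀⟩ := (isTransversal_univ hφ).exists_minimal_subset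
  rw [← mem_primeImplicants_cnfFun] at ht₀
  have hle_sup := fun t (ht : t ∈ primeImplicants (cnfFun φ)) =>
    Finset.le_sup (f := fun t => passBound φ T 38 t + 43 * length φ) ht
  refine ⟨out, total, hrun, hsorted, hmem, ?_, ?_⟩
  · refine Loop.isChain (p := fun t => passBound φ T 38 t + 10 * length φ) hrun hemit hprocess
      (fun t ht => ?_) ?_
    · have := hle_sup t ((hmem t).1 ht)
      omega
    · have := hle_sup t₀ ht₀
      omega
  · have hout : (out.map Prod.snd).toFinset = primeImplicants (cnfFun φ) := by
      ext t
      rw [List.mem_toFinset, hmem]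
    have htotal := Loop.total_le (p := fun t => passBound φ T 38 t + 10 * length φ) hrun hemit
      hprocess
    rw [← List.sum_toFinset _ (hsorted.imp fun h heq => h.ne (congrArg weight heq)), hout] at htotal
    have hcard : 1 ≤ (primeImplicants (cnfFun φ)).card := Finset.card_pos.2 ⟨t₀, ht₀⟩
    simp only [Finset.sum_add_distrib, Finset.sum_const, smul_eq_mul] at htotal ⊢
    nlinarith

theorem passBound_add (φ : Finset (Finset (Fin n))) (T : Finset (Fin n) → Fin n → ℕ) (C C' : ℕ)
    (t : Finset (Fin n)) : passBound φ T (C + C') t =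
      passBound φ T C t + (∑ i ∈ t, (rho φ t i).card) * (C' * length φ) := by
  rw [passBound, passBound, Finset.sum_mul, ← Finset.sum_add_distrib]
  exact Finset.sum_congr rfl fun i _ => by ring

theorem sum_card_rho_pos (hφ : IsAntichain (· ⊆ ·) (φ : Set (Finset (Fin n)))) {c : Finset (Fin n)}
    (hc : c ∈ φ) (hcard : 2 ≤ c.card) (ht : IsTransversal φ t) :
    0 < ∑ i ∈ t, (rho φ t i).card := by
  obtain ⟨i, hi⟩ := ht c hc
  obtain ⟨hic, hit⟩ := Finset.mem_inter.1 hi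
  have hres : ∅ ∉ residual φ i t := fun hempty => by
    rw [residual_eq_image] at hempty
    obtain ⟨d, hd, hdi⟩ := Finset.mem_image.1 hempty
    obtain ⟨hdφ, hid, -⟩ := mem_delta.1 (Finset.mem_filter.1 hd).1
    have hd : d = {i} := by rw [← Finset.insert_erase hid, hdi, insert_empty_eq]
    have hdc : d = c := hφ.eq hdφ hc (hd ▸ Finset.singleton_subset_iff.2 hic)
    rw [← hdc, hd, Finset.card_singleton] at hcard
    omega
  obtain ⟨r, -, hr⟩ := (isTransversal_univ hres).exists_minimal_subset
  exact Finset.sum_pos' (fun _ _ => Nat.zero_le _)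
    ⟨i, hit, Finset.card_pos.2 ⟨r, mem_primeImplicants_cnfFun.2 hr⟩⟩

theorem passBound_add_le (hφ : IsAntichain (· ⊆ ·) (φ : Set (Finset (Fin n)))) {c : Finset (Fin n)}
    (hc : c ∈ φ) (hcard : 2 ≤ c.card) (ht : IsTransversal φ t) (T : Finset (Fin n) → Fin n → ℕ)
    (C C' : ℕ) : passBound φ T C t + C' * length φ ≤ passBound φ T (C + C') t := by
  rw [passBound_add]
  exact Nat.add_le_add_left (Nat.le_mul_of_pos_left _ (sum_card_rho_pos hφ hc hcard ht)) _

theorem primeImplicants_cnfFun_eq_singleton_univ (hocc : ∀ j : Fin n, ∃ c ∈ φ, j ∈ c)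
    (hφ : ∀ c ∈ φ, c.card = 1) : primeImplicants (cnfFun φ) = {Finset.univ} := by
  have huniv : ∀ t, IsTransversal φ t ↔ t = Finset.univ := fun t => by
    refine ⟨fun ht => Finset.eq_univ_of_forall fun j => ?_, ?_⟩
    · obtain ⟨c, hc, hj⟩ := hocc j
      obtain ⟨k, hk⟩ := ht c hc
      obtain ⟨hkc, hkt⟩ := Finset.mem_inter.1 hk
      rwa [Finset.card_le_one.1 (hφ c hc).le j hj k hkc]
    · rintro rfl
      exact isTransversal_univ fun hempty => by simpa using hφ ∅ hempty
  ext t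
  rw [mem_primeImplicants_cnfFun, Finset.mem_singleton]
  exact ⟨fun ht => (huniv t).1 ht.prop, fun ht => ⟨(huniv t).2 ht, fun s hs _ =>
    (ht.trans ((huniv s).1 hs).symm).le⟩⟩

end Bounds

end Dualization

theorem mainTheorem6 :
    ∃ C : ℕ, ∀ (n : ℕ) (_ : 0 < n) (f : (Fin n → Bool) → Bool) (_ : Monotone f)
      (φ : Finset (Finset (Fin n))) (_ : Dualization.IsPrimeCNF f φ)
      (_ : ∀ j : Fin n, ∃ c ∈ φ, j ∈ c)
      (L : List (List (Fin n))) (_ : Dualization.Represents L φ)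
      (D : List (List (Fin n)) → Dualization.Timed (List (List (Fin n))))
      (T : Finset (Fin n) → Fin n → ℕ)
      (_ : ∀ t ∈ Dualization.primeImplicants f, ∀ i ∈ t, (Dualization.residual φ i t).Nonempty →
        ∀ Γ : List (List (Fin n)), Dualization.Represents Γ (Dualization.residual φ i t) →
          Dualization.Represents (D Γ).val (Dualization.rho φ t i) ∧ (D Γ).time ≤ T t i),
      ∃ (out : List (ℕ × Finset (Fin n))) (total : ℕ),
        Dualization.DualizeRun L D out total ∧
        (out.map Prod.snd).Pairwise (fun s t => Dualization.weight s < Dualization.weight t) ∧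
        (∀ t, t ∈ out.map Prod.snd ↔ t ∈ Dualization.primeImplicants f) ∧
        ((∃ c ∈ φ, 2 ≤ c.card) →
          Dualization.DelayAtMost
            ((Dualization.primeImplicants f).sup (Dualization.passBound φ T C)) out total ∧
          total ≤ ∑ t ∈ Dualization.primeImplicants f, Dualization.passBound φ T C t) ∧
        ((∀ c ∈ φ, c.card = 1) →
          Dualization.DelayAtMost
            ((Dualization.primeImplicants f).sup (Dualization.passBound φ T C)
              + C * Dualization.length φ) out total ∧
          total ≤ ∑ t ∈ Dualization.primeImplicants f, Dualization.passBound φ T C t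
              + C * Dualization.length φ) ∧
        (∀ t ∈ Dualization.primeImplicants f, ∀ i ∈ t,
          (Dualization.rho φ t i).card ≤ (Dualization.primeImplicants f).card) := by
  open Dualization in
  refine ⟨38 + 43, fun n hn f hf φ hφ hocc L hL D T hD => ?_⟩
  obtain ⟨c₀, hc₀, hmem₀⟩ := hocc ⟨0, hn⟩
  have hempty : ∅ ∉ φ := hφ.empty_notMem hc₀ ⟨_, hmem₀⟩
  have hanti := hφ.isAntichain
  have hlength : n ≤ length φ := le_length hocc
  obtain rfl : f = cnfFun φ := hφ.eq_cnfFun hf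
  obtain ⟨out, total, hrun, hsorted, hmem, hdelay, htotal⟩ :=
    exists_dualizeRun hempty hlength (hn.trans_le hlength) hL hD
  refine ⟨out, total, hrun, hsorted, hmem, fun ⟨c, hc, hcard⟩ => ?_, fun hunit => ?_,
    fun t ht i _ => card_rho_le (mem_primeImplicants_cnfFun.1 ht).prop i⟩
  · have hpass : ∀ t ∈ primeImplicants (cnfFun φ),
        passBound φ T 38 t + 43 * length φ ≤ passBound φ T (38 + 43) t := fun t ht =>
      passBound_add_le hanti hc hcard (mem_primeImplicants_cnfFun.1 ht).prop T 38 43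
    exact ⟨hdelay.mono (Finset.sup_mono_fun hpass), htotal.trans (Finset.sum_le_sum hpass)⟩
  · have hpass : passBound φ T 38 Finset.univ + 43 * length φ ≤
        passBound φ T (38 + 43) Finset.univ + (38 + 43) * length φ := by
      rw [passBound_add]
      omega
    rw [primeImplicants_cnfFun_eq_singleton_univ hocc hunit, Finset.sup_singleton] at hdelay ⊢
    rw [primeImplicants_cnfFun_eq_singleton_univ hocc hunit, Finset.sum_singleton] at htotal
    rw [Finset.sum_singleton]
    exact ⟨hdelay.mono hpass, htotal.trans hpass⟩
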